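/- Let $\Sigma$ be a compact translation surface with conical singularities: a compact Hausdorff space with a set $\mathfrak{B}$ of singularities, an atlas on $\Sigma\smallsetminus\mathfrak{B}$ with values in $\mathbb{R}^2$ and with locally constant translations as transition maps, such that each $\mathfrak{b}\in\mathfrak{B}$ is a cone point of angle $2\pi(n+1)$ for some $n\ge 0$ (there is a complex coordinate $\varphi$ centered at $\mathfrak{b}$ such that $\varphi^{n+1}$ is, away from $\mathfrak{b}$, locally a translation chart). Let $\mathfrak{W}\subset\Sigma\smallsetminus\mathfrak{B}$ be the union of the critical leaves, that is, the vertical leaves that run into a singularity in finite time, forward or backward. The divided surface $\widehat{\Sigma}$ has one point $\iota p$ for each $p\in\Sigma\smallsetminus\mathfrak{B}$ (called the median point if $p \in \mathfrak{W}$) and, for each $w\in\mathfrak{W}\cup\mathfrak{B}$, one right (left) lane point over $w$ for each germ of right (left) half-disk at $w$, i.e. each germ of a half-disk immersed by translations with vertical diameter centered at $w$ and lying to the right (left) of the diameter. Thus there is one lane point on each side for $w\in\mathfrak{W}$, and there are $m$ on each side for a singularity of cone angle $2\pi m$. Let $\pi\colon\widehat{\Sigma}\to\Sigma$ be the projection.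 A flow box in $\widehat{\Sigma}$ is given by an open rectangle in $\Sigma\smallsetminus\mathfrak{B}$ with vertical and horizontal sides (embedded by a map that is locally a translation), possibly with its left and/or right edge, to which the embedding must then extend continuously as a map into $\Sigma$. It consists of the $\pi$-preimage of the open rectangle, together with the right lane points along the left edge and the left lane points along the right edge that face the rectangle, whenever these edges are included. The trimmed flow box $\operatorname{trim} U\subset U$ is the $\pi$-preimage of the open rectangle. The topology of $\widehat{\Sigma}$ is generated by the flow boxes and the $\pi$-preimages of open sets of $\Sigma$. The maps $\pi$ and $\iota\colon\Sigma\smallsetminus\mathfrak{B}\to\widehat{\Sigma}$ are continuous. Let $G$ be a linear group: a subgroup of the automorphism group of a finite-dimensional vector space $R_G$ over a field $k$. Let $\mathcal{C}_G$ be the smallest category of $k$-vector spaces (with not necessarily all linear maps) that contains $R_G$, with $G$ as its endomorphisms, and has all limits and filtered colimits. Precisely: consider pairs $(V,P)$ of a $k$-vector space $V$ and a set $P$ of linear maps $R_G\to V$, with morphisms the linear maps that carry the given maps to given maps; $\mathcal{C}_G$ is the smallest full subcategory that contains $(R_G,G)$ and is closed under small limits and small filtered colimits. A $G$ local system on a locally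 connected space is a locally constant sheaf with values in $\mathcal{C}_G$ whose stalks are all isomorphic to $R_G$; morphisms of $G$ local systems are morphisms of sheaves. Theorem. For any linear group $G$, the direct image functors $\pi_*$, given by $(\pi_*\mathcal{F})(V)=\mathcal{F}(\pi^{-1}V)$ for $V\subset\Sigma\smallsetminus\mathfrak{B}$ open, and $\iota_*$ carry $G$ local systems to $G$ local systems, and they form an equivalence, inverse to each other up to natural isomorphism, between the category of $G$ local systems on $\widehat{\Sigma}$ and the category of $G$ local systems on $\Sigma\smallsetminus\mathfrak{B}$. Moreover, for any $G$ local system $\mathcal{F}$ on $\widehat{\Sigma}$ and any flow box $U$ in $\widehat{\Sigma}$, the restriction $\mathcal{F}(U)\to\mathcal{F}(\operatorname{trim} U)$ is an isomorphism. -/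

import Mathlib

open CategoryTheory CategoryTheory.Limits TopologicalSpace Topology Filter Opposite

universe u

noncomputable section

/-! ### Translation surfaces -/

/-- A translation structure with conical singularities on a space `X`. The plane is `ℂ`: the
real direction is horizontal (rightward), the imaginary direction is vertical (upward). -/
structure TranslationSurface (X : Type u) [TopologicalSpace X] where
  /-- the singularities -/
  sing : Set X
  /-- the translation charts, defined away from the singularities -/
  charts : Set (OpenPartialHomeomorph X ℂ)
  source_subset : ∀ e ∈ charts, e.source ⊆ singᶜ
  covers : ∀ p, p ∉ sing → ∃ e ∈ charts, p ∈ e.source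
  /-- the transition maps are (locally) translations -/
  transition : ∀ e ∈ charts, ∀ e' ∈ charts, ∀ p ∈ e.source ∩ e'.source,
    ∃ c : ℂ, ∀ᶠ q in 𝓝 p, e' q = e q + c
  /-- Every singularity `b` is a cone point of angle `2π(n+1)` for some `n ≥ 0`: there is a local
  coordinate `φ` centered at `b`, on a neighborhood free of other singularities, such that
  `φ ^ (n+1)` is locally a translation chart away from `b`. -/
  conical : ∀ b ∈ sing, ∃ (n : ℕ) (φ : OpenPartialHomeomorph X ℂ), b ∈ φ.source ∧ φ b = 0 ∧
    ∀ p ∈ φ.source, p ≠ b → p ∉ sing ∧ ∀ e ∈ charts, p ∈ e.source →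
      ∃ c : ℂ, ∀ᶠ q in 𝓝 p, e q = φ q ^ (n + 1) + c

namespace TranslationSurface

variable {X : Type u} [TopologicalSpace X] (S : TranslationSurface X)

lemma isOpen_compl_sing : IsOpen (S.singᶜ) := by
  rw [isOpen_iff_mem_nhds]
  intro p hp
  obtain ⟨e, he, hpe⟩ := S.covers p hp
  exact mem_of_superset (e.open_source.mem_nhds hpe) (S.source_subset e he)

/-- `γ` avoids the singularities and moves vertically upward at unit speed on the time set `J`. -/
def IsVerticalOn (γ : ℝ → X) (J : Set ℝ) : Prop :=
  ContinuousOn γ J ∧ ∀ t ∈ J, γ t ∉ S.sing ∧ ∀ e ∈ S.charts, γ t ∈ e.source →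
    ∀ᶠ s in 𝓝[J] t, e (γ s) = e (γ t) + ((s - t : ℝ) : ℂ) * Complex.I

/-- The union of the forward-critical leaves: the vertical flow carries the point into a
singularity in finite time. -/
def forwardCritical : Set X :=
  {p | ∃ (T : ℝ) (γ : ℝ → X), 0 < T ∧ ContinuousOn γ (Set.Icc 0 T) ∧
    S.IsVerticalOn γ (Set.Ico 0 T) ∧ γ 0 = p ∧ γ T ∈ S.sing}

/-- The union of the backward-critical leaves. -/
def backwardCritical : Set X :=
  {p | ∃ (T : ℝ) (γ : ℝ → X), 0 < T ∧ ContinuousOn γ (Set.Icc (-T) 0) ∧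
    S.IsVerticalOn γ (Set.Ioc (-T) 0) ∧ γ 0 = p ∧ γ (-T) ∈ S.sing}

/-- The union of the critical leaves. -/
def critical : Set X := S.forwardCritical ∪ S.backwardCritical

/-! ### The divided surface -/

inductive Side : Type
  | left
  | right

/-- A rectangle `(a, b) × (c, d)` drawn on the surface, away from the singularities. It may come
with its left edge `{a} × (c, d)` and with its right edge `{b} × (c, d)`; the map then extends
continuously to these edges, and the edges (but not the interior) may pass through singularities. -/
structure FlowBox where
  toFun : ℂ → X
  a : ℝ
  b : ℝ
  c : ℝ
  d : ℝ
  a_lt_b : a < b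
  c_lt_d : c < d
  /-- whether the left edge is included -/
  closedLeft : Prop
  /-- whether the right edge is included -/
  closedRight : Prop
  continuousOn : ContinuousOn toFun
    {z | (a < z.re ∨ closedLeft ∧ a = z.re) ∧ (z.re < b ∨ closedRight ∧ z.re = b) ∧
      c < z.im ∧ z.im < d}
  injOn : Set.InjOn toFun {z | a < z.re ∧ z.re < b ∧ c < z.im ∧ z.im < d}
  notMem_sing : ∀ z : ℂ, a < z.re → z.re < b → c < z.im → z.im < d → toFun z ∉ S.sing
  /-- in the charts of the surface, the map is locally a translation -/
  translation : ∀ z : ℂ, a < z.re → z.re < b → c < z.im → z.im < d →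
    ∀ e ∈ S.charts, toFun z ∈ e.source → ∀ᶠ z' in 𝓝 z, e (toFun z') = e (toFun z) + (z' - z)

namespace FlowBox

variable {S} (B : S.FlowBox)

/-- The open rectangle. -/
def interior : Set ℂ := {z | B.a < z.re ∧ z.re < B.b ∧ B.c < z.im ∧ z.im < B.d}

/-- The edge of the rectangle, if included, along which one sees the given side of a vertical
leaf: right-hand sides of leaves are seen along the left edge, and left-hand sides along the
right edge. -/
def edge : Side → Set ℂ
  | .right => {z | B.closedLeft ∧ z.re = B.a ∧ B.c < z.im ∧ z.im < B.d}
  | .left => {z | B.closedRight ∧ z.re = B.b ∧ B.c < z.im ∧ z.im < B.d}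

lemma isOpen_interior : IsOpen B.interior := by
  refine ((isOpen_lt continuous_const Complex.continuous_re).inter ?_)
  refine ((isOpen_lt Complex.continuous_re continuous_const).inter ?_)
  exact (isOpen_lt continuous_const Complex.continuous_im).inter
    (isOpen_lt Complex.continuous_im continuous_const)

lemma isOpen_image_interior : IsOpen (B.toFun '' B.interior) := by
  rw [isOpen_iff_mem_nhds]
  rintro _ ⟨z, hz, rfl⟩
  have hzn := B.isOpen_interior.mem_nhds hz
  have hcont : ContinuousAt B.toFun z := by
    refine (B.continuousOn.mono ?_).continuousAt hzn
    rintro w ⟨h1, h2, h3, h4⟩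
    exact ⟨Or.inl h1, Or.inl h2, h3, h4⟩
  obtain ⟨e, he, hpe⟩ := S.covers _ (B.notMem_sing z hz.1 hz.2.1 hz.2.2.1 hz.2.2.2)
  have hs : ∀ᶠ z' in 𝓝 z, B.toFun z' ∈ e.source :=
    hcont.eventually (e.open_source.mem_nhds hpe)
  have ht := B.translation z hz.1 hz.2.1 hz.2.2.1 hz.2.2.2 e he hpe
  have hlim : Tendsto (fun q => z + (e q - e (B.toFun z))) (𝓝 (B.toFun z)) (𝓝 z) := by
    have h := ((e.continuousAt hpe).tendsto.sub_const (e (B.toFun z))).const_add z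
    simpa using h
  filter_upwards [hlim.eventually hs, hlim.eventually ht, hlim.eventually hzn,
    e.open_source.mem_nhds hpe] with q h1 h2 h3 h4
  refine ⟨_, h3, e.injOn h1 h4 ?_⟩
  rw [h2]; ring

end FlowBox

/-- A lane point of the divided surface. It lies over a point `base` which is on a critical leaf
or is a singularity, and it is a way to stand infinitesimally close to `base`, on the given side
of the vertical line through it: a germ of half-disk with vertical diameter centered at `base`,
recorded by the filter `germ` of its neighborhoods in the surface. A point on a critical leaf has
exactly one left and one right lane point; a singularity of cone angle `2πm` has `m` left and `m`
right lane points, one for each pair of consecutive critical rays that end there. -/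
structure Lane where
  side : Side
  base : X
  germ : Filter X
  base_mem : base ∈ S.critical ∪ S.sing
  exists_box : ∃ (B : S.FlowBox) (z : ℂ), z ∈ B.edge side ∧ B.toFun z = base ∧
    germ = map B.toFun (𝓝[B.interior] z)

/-- The points of the divided surface: a point for every point off the singularities (if the point
is on a critical leaf this is its median point), and the lane points. -/
inductive Divided : Type u
  | point (p : X) (hp : p ∉ S.sing)
  | lane (l : S.Lane)

/-- The projection of the divided surface to the surface. -/
def projFun : S.Divided → X
  | .point p _ => p
  | .lane l => l.base

/-- The embedding of the surface minus its singularities in the divided surface. -/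
def embFun (p : (S.singᶜ : Set X)) : S.Divided := .point p.1 p.2

/-- The trimmed flow box: everything over the open rectangle. -/
def trimmedBox (B : S.FlowBox) : Set S.Divided := S.projFun ⁻¹' (B.toFun '' B.interior)

/-- The flow box in the divided surface: everything over the open rectangle, together with the
right lane points facing it along its left edge and the left lane points facing it along its right
edge, if these edges are included. (An edge that does not lie along critical leaves carries no
lane points.) -/
def dividedBox (B : S.FlowBox) : Set S.Divided :=
  S.trimmedBox B ∪ {x | ∃ l : S.Lane, x = .lane l ∧ ∃ z ∈ B.edge l.side,
    B.toFun z = l.base ∧ l.germ = map B.toFun (𝓝[B.interior] z)}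

/-- The topology of the divided surface is generated by the preimages of open sets of the surface
and by the flow boxes. Over a flow box `I × L` of the surface, it is the product of the topology of
the divided interval, generated by the preimages of open intervals of `I` and by the half-open
intervals whose end is the right lane point (left end) or the left lane point (right end) of a
critical position, with the topology of `L`. -/
instance : TopologicalSpace S.Divided :=
  generateFrom ({U | ∃ V : Set X, IsOpen V ∧ U = S.projFun ⁻¹' V} ∪
    {U | ∃ B : S.FlowBox, U = S.dividedBox B})

lemma continuous_projFun : Continuous S.projFun :=
  ⟨fun V hV => isOpen_generateFrom_of_mem (Or.inl ⟨V, hV, rfl⟩)⟩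

lemma continuous_embFun : Continuous S.embFun := by
  refine continuous_generateFrom_iff.2 ?_
  rintro U (⟨V, hV, rfl⟩ | ⟨B, rfl⟩)
  · exact hV.preimage continuous_subtype_val
  · have h : S.embFun ⁻¹' S.dividedBox B = Subtype.val ⁻¹' (B.toFun '' B.interior) := by
      ext p
      simp [embFun, dividedBox, trimmedBox, projFun]
    rw [h]
    exact B.isOpen_image_interior.preimage continuous_subtype_val

/-- The divided surface. -/
abbrev dividedTop : TopCat.{u} := TopCat.of S.Divided

/-- The surface minus its singularities. -/
abbrev puncturedTop : TopCat.{u} := TopCat.of (S.singᶜ : Set X)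

/-- The projection `π` of the divided surface to the surface. -/
def proj : S.dividedTop ⟶ TopCat.of X := TopCat.ofHom ⟨S.projFun, S.continuous_projFun⟩

/-- The embedding `ι` of the surface minus its singularities in the divided surface. -/
def emb : S.puncturedTop ⟶ S.dividedTop := TopCat.ofHom ⟨S.embFun, S.continuous_embFun⟩

/-- The inclusion of the surface minus its singularities in the surface. -/
def incl : S.puncturedTop ⟶ TopCat.of X := TopCat.ofHom ⟨Subtype.val, continuous_subtype_val⟩

lemma isOpenEmbedding_incl : IsOpenEmbedding S.incl :=
  S.isOpen_compl_sing.isOpenEmbedding_subtypeVal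

/-- The flow box as an open set of the divided surface. -/
def flowBox (B : S.FlowBox) : Opens S.dividedTop :=
  ⟨S.dividedBox B, isOpen_generateFrom_of_mem (Or.inr ⟨B, rfl⟩)⟩

/-- The trimmed flow box as an open set of the divided surface. -/
def trim (B : S.FlowBox) : Opens S.dividedTop :=
  ⟨S.trimmedBox B, B.isOpen_image_interior.preimage S.continuous_projFun⟩

lemma trim_le_flowBox (B : S.FlowBox) : S.trim B ≤ S.flowBox B :=
  Set.subset_union_left

variable (C : Type*) [Category.{u} C]

/-- The direct image functor `π_*`, from sheaves on the divided surface to sheaves on the surface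
minus its singularities: `(π_* F)(U) = F(π⁻¹ U)` for `U` open in the complement of the
singularities. -/
def projDirectImage : TopCat.Sheaf C S.dividedTop ⥤ TopCat.Sheaf C S.puncturedTop :=
  TopCat.Sheaf.pushforward C S.proj ⋙ S.isOpenEmbedding_incl.sheafPullback C

/-- The direct image functor `ι_*`. -/
def embDirectImage : TopCat.Sheaf C S.puncturedTop ⥤ TopCat.Sheaf C S.dividedTop :=
  TopCat.Sheaf.pushforward C S.emb

end TranslationSurface

/-! ### Local systems for a linear group -/

section LocalSystems

variable {k : Type u} [Field k] {R : Type u} [AddCommGroup R] [Module k R]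

/-- A vector space `V` with a set of linear maps `R → V` declared admissible. -/
structure FramedModule (k : Type u) [Field k] (R : Type u) [AddCommGroup R] [Module k R] where
  V : ModuleCat.{u} k
  frames : Set (R →ₗ[k] V)

/-- A morphism is a linear map that carries admissible maps to admissible maps. -/
@[ext]
structure FramedModule.Hom (M N : FramedModule k R) where
  lin : M.V →ₗ[k] N.V
  comp_mem : ∀ f ∈ M.frames, lin ∘ₗ f ∈ N.frames

instance : Category.{u} (FramedModule k R) where
  Hom M N := FramedModule.Hom M N
  id M := ⟨LinearMap.id, fun f hf => by simpa using hf⟩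
  comp f g := ⟨g.lin ∘ₗ f.lin, fun h hh => by
    rw [LinearMap.comp_assoc]; exact g.comp_mem _ (f.comp_mem _ hh)⟩

/-- The object `R` itself, where the admissible maps `R → R` are the elements of `G`. Its
endomorphisms are the elements of `G`. -/
def FramedModule.base (G : Subgroup (R ≃ₗ[k] R)) : FramedModule k R where
  V := ModuleCat.of k R
  frames := {f | ∃ g ∈ G, f = (g : R →ₗ[k] R)}

/-- The objects that can be built from `R`, with automorphism group `G`, by (iterated) small limits
and small filtered colimits. -/
def linearGroupProperty (G : Subgroup (R ≃ₗ[k] R)) : ObjectProperty (FramedModule k R) :=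
  fun M => ∀ Q : ObjectProperty (FramedModule k R), Q (FramedModule.base G) →
    (∀ (J : Type u) [SmallCategory J], Q.IsClosedUnderLimitsOfShape J) →
    (∀ (J : Type u) [SmallCategory J] [IsFiltered J], Q.IsClosedUnderColimitsOfShape J) → Q M

/-- The target category of `G` local systems: it contains `R`, with `G` as the morphisms `R ⟶ R`,
has all limits and filtered colimits, computed as for vector spaces, and is the smallest such. -/
abbrev LinearGroupCat (G : Subgroup (R ≃ₗ[k] R)) := (linearGroupProperty G).FullSubcategory

/-- The object `R` of the target category. -/
def LinearGroupCat.base (G : Subgroup (R ≃ₗ[k] R)) : LinearGroupCat G :=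
  ⟨FramedModule.base G, fun _ h _ _ => h⟩

variable {C : Type*} [Category.{u} C] {Y : TopCat.{u}}

/-- The open set `U` is simple with respect to the sheaf `F`: the restriction of `F` to `U` is
isomorphic to the constant sheaf with some value `A`, that is (on a locally connected space), to
the sheaf that sends every non-empty connected open set to `A` and every inclusion of such sets to
the identity of `A`. -/
def IsSimple (F : TopCat.Sheaf C Y) (U : Opens Y) : Prop :=
  ∃ (A : C) (φ : ∀ V : Opens Y, V ≤ U → IsConnected (V : Set Y) → (F.1.obj (op V) ≅ A)),
    ∀ (V W : Opens Y) (hVW : V ≤ W) (hW : W ≤ U) (hVc : IsConnected (V : Set Y))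
      (hWc : IsConnected (W : Set Y)),
      F.1.map (homOfLE hVW).op ≫ (φ V (hVW.trans hW) hVc).hom = (φ W hW hWc).hom

/-- A sheaf is locally constant if every point has a simple open neighborhood. -/
def IsLocallyConstantSheaf (F : TopCat.Sheaf C Y) : Prop :=
  ∀ y : Y, ∃ U : Opens Y, y ∈ U ∧ IsSimple F U

/-- The stalk of `F` at `y`, the colimit of the values of `F` on the open neighborhoods of `y`,
exists and is isomorphic to `A`. -/
def HasStalkIso (F : TopCat.Sheaf C Y) (y : Y) (A : C) : Prop :=
  ∃ s : Cocone ((OpenNhds.inclusion y).op ⋙ F.1), Nonempty (IsColimit s) ∧ Nonempty (s.pt ≅ A)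

/-- `G` local systems: locally constant sheaves whose stalks are all isomorphic to `R`. -/
def isLocalSystem (G : Subgroup (R ≃ₗ[k] R)) (Y : TopCat.{u}) :
    ObjectProperty (TopCat.Sheaf (LinearGroupCat G) Y) :=
  fun F => IsLocallyConstantSheaf F ∧ ∀ y : Y, HasStalkIso F y (LinearGroupCat.base G)

/-- The category of `G` local systems on `Y`, with all morphisms of sheaves. -/
abbrev LocalSystem (G : Subgroup (R ≃ₗ[k] R)) (Y : TopCat.{u}) :=
  (isLocalSystem G Y).FullSubcategory

end LocalSystems

end

/-! ### Sheaves with values in a category without structure -/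

section Sheaves

variable {C : Type*} [Category.{u} C] {Y : TopCat.{u}}

/-! For `U` open in the divided surface let `shadow U` be its preimage under `ι`; for `V` open in
the punctured surface let `above V` be its preimage under `π`. Then `(ι_* E)(U) = E(shadow U)` and
`(π_* F)(V) = F(above V)`. Since `shadow (above V) = V`, the composite `π_* ι_*` is the identity up
to isomorphism, on all sheaves.

For the other composite, `above (shadow U) ≤ U`: a neighborhood of `ι p` contains all points over
some neighborhood of `p`. What has to be shown is that `F(U) ⟶ F(above (shadow U))` is invertible
for locally constant `F` (`isIso_resLE_above_shadow`). Every point has arbitrarily small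
neighborhoods `N` with connected shadow (`exists_connected_shadow`). Then `N` and `above (shadow N)`
are connected too, so on a simple open set `F` takes the same value on both, and gluing gives the
general case. If `U` is a flow box, `above (shadow U)` is its trim, whence the last claim.

Simple sets of `F` yield simple sets of `π_* F`, and conversely for `ι_*`, because `above` and
`shadow` preserve connectedness. At a lane point, local constancy of `ι_* E` has real content: the
shadow of a flow box is an open rectangle, and a locally constant sheaf is constant on it
(`isUniform_box`).

Objects of the target category are not handled through elements; a morphism `T ⟶ F(U)` plays the
part of a section over `U`. -/

/-- The restriction map of a sheaf. -/
def resLE (F : TopCat.Sheaf C Y) {V U : Opens Y} (h : V ≤ U) :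
    F.1.obj (op U) ⟶ F.1.obj (op V) :=
  F.1.map (homOfLE h).op

lemma resLE_comp (F : TopCat.Sheaf C Y) {W V U : Opens Y} (h : V ≤ U) (h' : W ≤ V) :
    resLE F h ≫ resLE F h' = resLE F (h'.trans h) := by
  simp only [resLE, ← F.1.map_comp]
  rfl

lemma resLE_comp_assoc (F : TopCat.Sheaf C Y) {W V U : Opens Y} (h : V ≤ U) (h' : W ≤ V) {A : C}
    (f : F.1.obj (op W) ⟶ A) :
    resLE F h ≫ resLE F h' ≫ f = resLE F (h'.trans h) ≫ f := by
  rw [← Category.assoc, resLE_comp]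

/-- The sheaf condition tested against an object `T`: the presheaf of sets `Hom(T, F(-))` is a
sheaf. The union is a separate variable `U`, so that no transport along equalities of open sets is
needed later. -/
lemma exists_glue (F : TopCat.Sheaf C Y) {T : C} {ι : Type*} (V : ι → Opens Y) (U : Opens Y)
    (hVU : ∀ i, V i ≤ U) (hcov : ∀ y ∈ U, ∃ i, y ∈ V i) (s : ∀ i, T ⟶ F.1.obj (op (V i)))
    (hs : ∀ i j, s i ≫ resLE F (inf_le_left : V i ⊓ V j ≤ V i) =
      s j ≫ resLE F (inf_le_right : V i ⊓ V j ≤ V j)) :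
    ∃! t : T ⟶ F.1.obj (op U), ∀ i, t ≫ resLE F (hVU i) = s i := by
  obtain rfl : U = iSup V := le_antisymm
    (fun y hy => Opens.mem_iSup.2 (hcov y hy)) (iSup_le hVU)
  exact TopCat.Presheaf.IsSheaf.isSheafUniqueGluing_types
    ((isSheaf_iff_isSheaf_of_type _ _).2 (F.2 T)) (U := V) s hs

lemma hom_ext_of_cover (F : TopCat.Sheaf C Y) {T : C} {U : Opens Y} (s t : T ⟶ F.1.obj (op U))
    (h : ∀ y ∈ U, ∃ (V : Opens Y) (hV : V ≤ U), y ∈ V ∧ s ≫ resLE F hV = t ≫ resLE F hV) :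
    s = t := by
  choose V hV hy hst using h
  obtain ⟨r, -, hr⟩ := exists_glue F (fun y : U => V y.1 y.2) U (fun y => hV _ _)
    (fun y hy' => ⟨⟨y, hy'⟩, hy _ _⟩) (fun y => s ≫ resLE F (hV _ _))
    (fun i j => by simp only [Category.assoc, resLE_comp])
  exact (hr s fun i => rfl).trans (hr t fun i => (hst _ _).symm).symm

/-! ### Constancy of a sheaf on an open set -/

/-- The sheaf `F` is constant on the connected open set `U`, with value `F(U)`. -/
def IsUniform (F : TopCat.Sheaf C Y) (U : Opens Y) : Prop :=
  ∀ (V : Opens Y) (h : V ≤ U), IsConnected (V : Set Y) → IsIso (resLE F h)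

lemma isIso_resLE_trans (F : TopCat.Sheaf C Y) {W V U : Opens Y} (h : V ≤ U) (h' : W ≤ V)
    [IsIso (resLE F h)] [IsIso (resLE F h')] : IsIso (resLE F (h'.trans h)) := by
  rw [← resLE_comp F h h']; infer_instance

lemma isIso_resLE_of_trans (F : TopCat.Sheaf C Y) {W V U : Opens Y} (h : V ≤ U) (h' : W ≤ V)
    [IsIso (resLE F (h'.trans h))] [IsIso (resLE F h)] : IsIso (resLE F h') := by
  have := resLE_comp F h h'
  exact @IsIso.of_isIso_fac_left _ _ _ _ _ _ _ _ _ ‹_› this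

lemma isIso_resLE_of_trans' (F : TopCat.Sheaf C Y) {W V U : Opens Y} (h : V ≤ U) (h' : W ≤ V)
    [IsIso (resLE F (h'.trans h))] [IsIso (resLE F h')] : IsIso (resLE F h) := by
  have := resLE_comp F h h'
  exact @IsIso.of_isIso_fac_right _ _ _ _ _ _ _ _ _ ‹_› this

lemma IsUniform.isIso {F : TopCat.Sheaf C Y} {U : Opens Y} (hF : IsUniform F U) {W V : Opens Y}
    (h : W ≤ V) (hV : V ≤ U) (hWc : IsConnected (W : Set Y)) (hVc : IsConnected (V : Set Y)) :
    IsIso (resLE F h) :=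
  have := hF V hV hVc
  have := hF W (h.trans hV) hWc
  isIso_resLE_of_trans F hV h

lemma IsUniform.mono {F : TopCat.Sheaf C Y} {U V : Opens Y} (hF : IsUniform F U) (h : V ≤ U)
    (hVc : IsConnected (V : Set Y)) : IsUniform F V :=
  fun _ hW hWc => hF.isIso hW h hWc hVc

lemma IsSimple.isIso {F : TopCat.Sheaf C Y} {U : Opens Y} (hF : IsSimple F U) {V W : Opens Y}
    (hVW : V ≤ W) (hW : W ≤ U) (hVc : IsConnected (V : Set Y)) (hWc : IsConnected (W : Set Y)) :
    IsIso (resLE F hVW) := by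
  obtain ⟨A, φ, hφ⟩ := hF
  have h := hφ V W hVW hW hVc hWc
  exact @IsIso.of_isIso_fac_right _ _ _ _ _ _ _ _ _ inferInstance h

lemma IsSimple.isUniform {F : TopCat.Sheaf C Y} {U V : Opens Y} (hF : IsSimple F U) (h : V ≤ U)
    (hVc : IsConnected (V : Set Y)) : IsUniform F V :=
  fun _ hW hWc => hF.isIso hW h hWc hVc

lemma IsUniform.isSimple {F : TopCat.Sheaf C Y} {U : Opens Y} (hF : IsUniform F U) :
    IsSimple F U := by
  refine ⟨F.1.obj (op U), fun V hV hVc => (@asIso _ _ _ _ _ (hF V hV hVc)).symm, ?_⟩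
  intro V W hVW hW hVc hWc
  have := hF V (hVW.trans hW) hVc
  have := hF W hW hWc
  change resLE F hVW ≫ inv (resLE F (hVW.trans hW)) = inv (resLE F hW)
  rw [IsIso.comp_inv_eq, IsIso.eq_inv_comp, resLE_comp]

lemma isIso_of_bijective {A B : C} (f : A ⟶ B)
    (h₁ : ∀ (T : C) (s t : T ⟶ A), s ≫ f = t ≫ f → s = t)
    (h₂ : ∀ (T : C) (s : T ⟶ B), ∃ t : T ⟶ A, t ≫ f = s) : IsIso f :=
  isIso_of_yoneda_map_bijective f fun T => ⟨fun s t h => h₁ T s t h, fun s => h₂ T s⟩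

/-- The connected component of `y` in an open set `U`, in a locally connected space. -/
def componentIn [LocallyConnectedSpace Y] (U : Opens Y) (y : Y) : Opens Y :=
  ⟨connectedComponentIn U y, U.2.connectedComponentIn⟩

lemma HasStalkIso.unique {F : TopCat.Sheaf C Y} {y : Y} {A B : C} (h : HasStalkIso F y A)
    (h' : HasStalkIso F y B) : Nonempty (A ≅ B) := by
  obtain ⟨s, ⟨hs⟩, ⟨i⟩⟩ := h
  obtain ⟨t, ⟨ht⟩, ⟨j⟩⟩ := h'
  exact ⟨i.symm ≪≫ hs.coconePointUniqueUpToIso ht ≪≫ j⟩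

lemma HasStalkIso.of_iso {F : TopCat.Sheaf C Y} {y : Y} {A B : C} (h : HasStalkIso F y A)
    (e : A ≅ B) : HasStalkIso F y B := by
  obtain ⟨s, hs, ⟨i⟩⟩ := h
  exact ⟨s, hs, ⟨i ≪≫ e⟩⟩

section LocallyConnected

variable [LocallyConnectedSpace Y]

lemma componentIn_le (U : Opens Y) (y : Y) : componentIn U y ≤ U :=
  connectedComponentIn_subset _ _

lemma isConnected_componentIn {U : Opens Y} {y : Y} (h : y ∈ U) :
    IsConnected (componentIn U y : Set Y) :=
  isConnected_connectedComponentIn_iff.2 h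

lemma mem_componentIn {U : Opens Y} {y : Y} (h : y ∈ U) : y ∈ componentIn U y :=
  mem_connectedComponentIn h

lemma componentIn_mono {U V : Opens Y} (h : U ≤ V) (y : Y) : componentIn U y ≤ componentIn V y :=
  connectedComponentIn_mono y h

/-- A sheaf is constant on `U` if its value on `U` agrees with its values on small connected
open sets. -/
lemma isUniform_of_locally (F : TopCat.Sheaf C Y) {U : Opens Y}
    (h : ∀ y ∈ U, ∃ N : Opens Y, y ∈ N ∧ ∀ (V : Opens Y) (hVU : V ≤ U), V ≤ N →
      IsConnected (V : Set Y) → IsIso (resLE F hVU)) : IsUniform F U := by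
  intro W hW hWc
  choose N hyN hN using h
  -- A section over `U` is determined near any one point, because `F(U)` maps isomorphically to the
  -- values on small connected sets.
  have inj (T : C) (a b : T ⟶ F.1.obj (op U)) (V : Opens Y) (hV : V ≤ U) (y : Y) (hy : y ∈ V)
      (hab : a ≫ resLE F hV = b ≫ resLE F hV) : a = b := by
    have hyU := hV hy
    have hy' : y ∈ V ⊓ N y hyU := ⟨hy, hyN y hyU⟩
    have hle := componentIn_le (V ⊓ N y hyU) y
    have := hN y hyU _ ((hle.trans inf_le_left).trans hV) (hle.trans inf_le_right)
      (isConnected_componentIn hy')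
    rw [← cancel_mono (resLE F ((hle.trans inf_le_left).trans hV)),
      ← resLE_comp F hV (hle.trans inf_le_left), reassoc_of% hab]
  obtain ⟨x₀, hx₀⟩ := hWc.nonempty
  refine isIso_of_bijective _ (fun T a b hab => inj T a b W hW x₀ hx₀ hab) fun T s => ?_
  -- `O a` is where `s` locally agrees with the global section `a`. These sets are open, cover `W`
  -- and are pairwise disjoint by `inj`; as `W` is connected, one of them contains it.
  let O (a : T ⟶ F.1.obj (op U)) : Set Y :=
    {y | ∃ (V : Opens Y) (hV : V ≤ W), y ∈ V ∧ a ≫ resLE F (hV.trans hW) = s ≫ resLE F hV}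
  have hO (a) : IsOpen (O a) := isOpen_iff_forall_mem_open.2 fun y ⟨V, hV, hy, e⟩ =>
    ⟨V, fun z hz => ⟨V, hV, hz, e⟩, V.2, hy⟩
  have hcov (y : Y) (hy : y ∈ W) : ∃ a, y ∈ O a := by
    have hyU := hW hy
    have hy' : y ∈ W ⊓ N y hyU := ⟨hy, hyN y hyU⟩
    have hle := componentIn_le (W ⊓ N y hyU) y
    have := hN y hyU _ ((hle.trans inf_le_left).trans hW) (hle.trans inf_le_right)
      (isConnected_componentIn hy')
    exact ⟨s ≫ resLE F (hle.trans inf_le_left) ≫ inv (resLE F ((hle.trans inf_le_left).trans hW)),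
      _, hle.trans inf_le_left, mem_componentIn hy', by simp⟩
  have hdisj (a b) (y : Y) (ha : y ∈ O a) (hb : y ∈ O b) : a = b := by
    obtain ⟨V, hV, hy, e⟩ := ha
    obtain ⟨V', hV', hy', e'⟩ := hb
    refine inj T a b (V ⊓ V') ((inf_le_left.trans hV).trans hW) y ⟨hy, hy'⟩ ?_
    rw [← resLE_comp F (hV.trans hW) inf_le_left, reassoc_of% e, resLE_comp,
      ← resLE_comp F hV' inf_le_right, ← reassoc_of% e', resLE_comp F (hV'.trans hW), resLE_comp]
  obtain ⟨a, ha⟩ := hcov x₀ hx₀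
  refine ⟨a, hom_ext_of_cover F _ _ fun y hy => ?_⟩
  suffices hya : y ∈ O a by
    obtain ⟨V, hV, hy, e⟩ := hya
    exact ⟨V, hV, hy, by rw [Category.assoc, resLE_comp, e]⟩
  by_contra hya
  obtain ⟨b, hb⟩ := hcov y hy
  obtain ⟨z, hz, hz₁, hz₂⟩ := hWc.isPreconnected (O a) (⋃ b ∈ {b | b ≠ a}, O b) (hO a)
    (isOpen_biUnion fun b _ => hO b) (fun z hz => by
      obtain ⟨c, hc⟩ := hcov z hz
      by_cases h : c = a
      · exact Or.inl (h ▸ hc)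
      · exact Or.inr (Set.mem_biUnion h hc)) ⟨x₀, hx₀, ha⟩
    ⟨y, hy, Set.mem_biUnion (show b ≠ a by rintro rfl; exact hya hb) hb⟩
  obtain ⟨c, hc, hzc⟩ := Set.mem_iUnion₂.1 hz₂
  exact hc (hdisj _ _ z hzc hz₁)

/-- A sheaf is constant on a union of open sets with connected intersections and a common core if
it is so on each. -/
lemma isUniform_of_cover (F : TopCat.Sheaf C Y) {ι : Type*} [Nonempty ι] (V : ι → Opens Y)
    (U K : Opens Y) (hVU : ∀ i, V i ≤ U) (hcov : ∀ y ∈ U, ∃ i, y ∈ V i) (hK : ∀ i, K ≤ V i)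
    (hKc : IsConnected (K : Set Y)) (hVV : ∀ i j, IsConnected ((V i ⊓ V j : Opens Y) : Set Y))
    (hV : ∀ i, IsUniform F (V i)) : IsUniform F U := by
  have hUK (i) : IsIso (resLE F ((hK i).trans (hVU i))) := by
    refine isIso_of_bijective _ (fun T a b hab => ?_) fun T s => ?_
    · refine hom_ext_of_cover F _ _ fun y hy => ?_
      obtain ⟨j, hj⟩ := hcov y hy
      refine ⟨V j, hVU j, hj, ?_⟩
      have := hV j K (hK j) hKc
      rw [← cancel_mono (resLE F (hK j))]
      simpa only [Category.assoc, resLE_comp] using hab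
    · have hKV (j) := hV j K (hK j) hKc
      -- Extend `s` from the core `K` to each `V j`. Two extensions agree on `V i ⊓ V j`, which is
      -- connected, so that restriction from it to `K` is invertible.
      obtain ⟨t, ht, -⟩ := exists_glue F V U hVU hcov (fun j => s ≫ inv (resLE F (hK j)))
        fun i j => by
          have := (hV i).isIso (le_inf (hK i) (hK j)) inf_le_left hKc (hVV i j)
          rw [← cancel_mono (resLE F (le_inf (hK i) (hK j)))]
          simp only [Category.assoc, resLE_comp, IsIso.inv_hom_id]
      refine ⟨t, ?_⟩
      rw [← resLE_comp F (hVU i) (hK i), reassoc_of% (ht i)]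
      simp
  refine isUniform_of_locally F fun y hy => ?_
  obtain ⟨i, hi⟩ := hcov y hy
  refine ⟨V i, hi, fun W hWU hWi hWc => ?_⟩
  have := hUK i
  have := hV i K (hK i) hKc
  have := isIso_resLE_of_trans' F (hVU i) (hK i)
  have := hV i W hWi hWc
  exact isIso_resLE_trans F (hVU i) hWi

/-- The stalk of a sheaf at a point of a simple open set. -/
lemma IsSimple.hasStalkIso {F : TopCat.Sheaf C Y} {U : Opens Y} (hF : IsSimple F U) {y : Y}
    (hy : y ∈ U) : HasStalkIso F y (F.1.obj (op (componentIn U y))) := by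
  -- The components `c V` are cofinal among the neighborhoods of `y`, and all restrictions between
  -- them are invertible, so the colimit is already reached at the component of `U`.
  let c (V : OpenNhds y) : Opens Y := componentIn (V.1 ⊓ U) y
  have hcV (V : OpenNhds y) : c V ≤ V.1 := (componentIn_le _ _).trans inf_le_left
  have hcU (V : OpenNhds y) : c V ≤ componentIn U y := componentIn_mono inf_le_right _
  have hcc (V : OpenNhds y) : IsConnected (c V : Set Y) := isConnected_componentIn ⟨V.2, hy⟩
  have hU := hF.isUniform (componentIn_le U y) (isConnected_componentIn hy)
  have hiso (V : OpenNhds y) := hU (c V) (hcU V) (hcc V)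
  have hmono {V W : OpenNhds y} (h : V ≤ W) : c V ≤ c W :=
    componentIn_mono (inf_le_inf_right _ h) _
  let p (V : OpenNhds y) : F.1.obj (op V.1) ⟶ F.1.obj (op (componentIn U y)) :=
    resLE F (hcV V) ≫ inv (resLE F (hcU V))
  have hp (V W : OpenNhds y) (h : W.1 ≤ V.1) : resLE F h ≫ p W = p V := by
    have e : inv (resLE F (hcU V)) = resLE F (hmono h) ≫ inv (resLE F (hcU W)) := by
      rw [IsIso.eq_comp_inv, IsIso.inv_comp_eq, resLE_comp]
    simp only [p, e, resLE_comp_assoc]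
  let s : Cocone ((OpenNhds.inclusion y).op ⋙ F.1) :=
    { pt := F.1.obj (op (componentIn U y))
      ι :=
      { app := fun V => p V.unop
        naturality := fun V W f =>
          (hp V.unop W.unop (leOfHom f.unop)).trans (Category.comp_id _).symm } }
  let U' : OpenNhds y := ⟨componentIn U y, mem_componentIn hy⟩
  have hpU : p U' = 𝟙 _ := (IsIso.comp_inv_eq _).2 (Category.id_comp _).symm
  refine ⟨s, ⟨⟨fun t => t.ι.app (op U'), fun t V => ?_, fun t m hm => ?_⟩⟩, ⟨Iso.refl _⟩⟩
  · let V' : OpenNhds y := ⟨c V.unop, mem_componentIn ⟨V.unop.2, hy⟩⟩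
    have h₁ : resLE F (hcV V.unop) ≫ t.ι.app (op V') = t.ι.app V :=
      t.w (show V ⟶ op V' from (homOfLE (hcV V.unop) : V' ⟶ V.unop).op)
    have h₂ : resLE F (hcU V.unop) ≫ t.ι.app (op V') = t.ι.app (op U') :=
      t.w (show op U' ⟶ op V' from (homOfLE (hcU V.unop) : V' ⟶ U').op)
    refine Eq.trans ?_ h₁
    refine (Category.assoc _ _ _).trans (congrArg (resLE F (hcV V.unop) ≫ ·) ?_)
    exact (IsIso.inv_comp_eq _).2 h₂.symm
  · refine Eq.trans ?_ (hm (op U'))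
    exact (Category.id_comp m).symm.trans (congrArg (· ≫ m) hpU.symm)

end LocallyConnected

end Sheaves

/-! ### Flow boxes -/

namespace TranslationSurface

/-- The open half-plane on the given side of the vertical line through `z`. -/
def halfPlane : Side → ℂ → Set ℂ
  | .right, z => {w | z.re < w.re}
  | .left, z => {w | w.re < z.re}

/-- The open square with center `z`. -/
def square (z : ℂ) (ε : ℝ) : Set ℂ := {w | |w.re - z.re| < ε ∧ |w.im - z.im| < ε}

lemma isOpen_square (z : ℂ) (ε : ℝ) : IsOpen (square z ε) :=
  (isOpen_lt (Complex.continuous_re.sub continuous_const).abs continuous_const).inter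
    (isOpen_lt (Complex.continuous_im.sub continuous_const).abs continuous_const)

lemma mem_square_self (z : ℂ) {ε : ℝ} (hε : 0 < ε) : z ∈ square z ε := by simpa [square] using hε

lemma square_mono (z : ℂ) {ε δ : ℝ} (h : ε ≤ δ) : square z ε ⊆ square z δ :=
  fun _ hw => ⟨hw.1.trans_le h, hw.2.trans_le h⟩

lemma hasBasis_square (z : ℂ) : (𝓝 z).HasBasis (fun ε : ℝ => 0 < ε) (square z) := by
  refine ⟨fun N => ⟨fun hN => ?_, fun ⟨ε, hε, h⟩ =>
    mem_of_superset ((isOpen_square z ε).mem_nhds (mem_square_self z hε)) h⟩⟩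
  obtain ⟨ε, hε, h⟩ := Metric.mem_nhds_iff.1 hN
  refine ⟨ε / 2, half_pos hε, fun w hw => h ?_⟩
  rw [Metric.mem_ball, dist_eq_norm]
  have := Complex.norm_le_abs_re_add_abs_im (w - z)
  simp only [Complex.sub_re, Complex.sub_im] at this
  linarith [hw.1, hw.2]

lemma convex_halfPlane_inter_square (s : Side) (z : ℂ) (ε : ℝ) :
    Convex ℝ (halfPlane s z ∩ square z ε) := by
  have h₁ : Convex ℝ (halfPlane s z) := by
    cases s
    · exact convex_halfSpace_re_lt z.re
    · exact convex_halfSpace_re_gt z.re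
  refine h₁.inter ?_
  have : square z ε = (({w : ℂ | w.re < z.re + ε} ∩ {w | z.re - ε < w.re}) ∩
      ({w | w.im < z.im + ε} ∩ {w | z.im - ε < w.im})) := by
    ext w
    simp only [square, abs_lt, Set.mem_ofPred_eq, Set.mem_inter_iff]
    constructor
    · rintro ⟨⟨_, _⟩, _, _⟩
      refine ⟨⟨?_, ?_⟩, ?_, ?_⟩ <;> linarith
    · rintro ⟨⟨_, _⟩, _, _⟩
      refine ⟨⟨?_, ?_⟩, ?_, ?_⟩ <;> linarith
  rw [this]
  exact ((convex_halfSpace_re_lt _).inter (convex_halfSpace_re_gt _)).inter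
    ((convex_halfSpace_im_lt _).inter (convex_halfSpace_im_gt _))

lemma halfPlane_inter_square_nonempty (s : Side) (z : ℂ) {ε : ℝ} (hε : 0 < ε) :
    (halfPlane s z ∩ square z ε).Nonempty := by
  cases s
  · refine ⟨z - (ε / 2 : ℝ), ?_, ?_, ?_⟩
    · simp [halfPlane, hε]
    · simp [abs_of_pos (half_pos hε), hε]
    · simpa using hε
  · refine ⟨z + (ε / 2 : ℝ), ?_, ?_, ?_⟩
    · simp [halfPlane, hε]
    · simp [abs_of_pos (half_pos hε), hε]
    · simpa using hε

instance neBot_nhdsWithin_halfPlane (s : Side) (z : ℂ) : (𝓝[halfPlane s z] z).NeBot := by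
  refine ((hasBasis_square z).inf_principal _).neBot_iff.2 ?_
  intro ε hε
  rw [Set.inter_comm]
  exact halfPlane_inter_square_nonempty s z hε

lemma exists_square_of_eventually {s : Side} {z : ℂ} {p : ℂ → Prop}
    (h : ∀ᶠ w in 𝓝[halfPlane s z] z, p w) :
    ∃ δ > 0, ∀ w ∈ halfPlane s z ∩ square z δ, p w := by
  obtain ⟨δ, hδ, h⟩ := ((hasBasis_square z).inf_principal _).eventually_iff.1 h
  exact ⟨δ, hδ, fun w hw => h hw.symm⟩

/-- Lets a germ of half-disk be carried from one flow box to another that differs from it by a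
translation. -/
lemma map_add_right_nhdsWithin_halfPlane (s : Side) (z k : ℂ) :
    map (· + k) (𝓝[halfPlane s z] z) = 𝓝[halfPlane s (z + k)] (z + k) := by
  have h := (Homeomorph.addRight k).isInducing.map_nhdsWithin_eq (halfPlane s z) z
  refine h.trans (congrArg (fun A => 𝓝[A] (z + k)) ?_)
  ext w
  simp only [Homeomorph.coe_addRight, Set.image_add_right, Set.mem_preimage]
  cases s <;> simp only [halfPlane, Set.mem_ofPred_eq, Complex.add_re, Complex.neg_re] <;>
    constructor <;> intro <;> linarith

variable {X : Type u} [TopologicalSpace X] {S : TranslationSurface X}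

namespace FlowBox

variable (B : S.FlowBox)

/-- The open rectangle, with the edges that are included. -/
def domain : Set ℂ :=
  {z | (B.a < z.re ∨ B.closedLeft ∧ B.a = z.re) ∧ (z.re < B.b ∨ B.closedRight ∧ z.re = B.b) ∧
    B.c < z.im ∧ z.im < B.d}

lemma interior_subset_domain : B.interior ⊆ B.domain :=
  fun _ h => ⟨Or.inl h.1, Or.inl h.2.1, h.2.2⟩

lemma edge_subset_domain (s : Side) : B.edge s ⊆ B.domain := by
  have := B.a_lt_b
  cases s
  · rintro z ⟨h, h₁, h₂⟩
    exact ⟨Or.inl (by rwa [h₁]), Or.inr ⟨h, h₁⟩, h₂⟩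
  · rintro z ⟨h, h₁, h₂⟩
    exact ⟨Or.inr ⟨h, h₁.symm⟩, Or.inl (by rwa [h₁]), h₂⟩

lemma continuousOn_domain : ContinuousOn B.toFun B.domain := B.continuousOn

lemma continuousAt {z : ℂ} (hz : z ∈ B.interior) : ContinuousAt B.toFun z :=
  (B.continuousOn_domain.mono B.interior_subset_domain).continuousAt
    (B.isOpen_interior.mem_nhds hz)

lemma injOn_interior : Set.InjOn B.toFun B.interior := B.injOn

lemma toFun_notMem_sing {z : ℂ} (hz : z ∈ B.interior) : B.toFun z ∉ S.sing :=
  B.notMem_sing z hz.1 hz.2.1 hz.2.2.1 hz.2.2.2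

lemma convex_interior : Convex ℝ B.interior :=
  (convex_halfSpace_re_gt _).inter ((convex_halfSpace_re_lt _).inter
    ((convex_halfSpace_im_gt _).inter (convex_halfSpace_im_lt _)))

lemma interior_nonempty : B.interior.Nonempty := by
  have h₁ := B.a_lt_b
  have h₂ := B.c_lt_d
  refine ⟨⟨(B.a + B.b) / 2, (B.c + B.d) / 2⟩, ?_, ?_, ?_, ?_⟩ <;> simp only <;> linarith

/-- A smaller rectangle, with its left or right edge if it lies on that of the given one. -/
def restrict (a b c d : ℝ) (hab : a < b) (hcd : c < d) (ha : B.a ≤ a) (hb : b ≤ B.b) (hc : B.c ≤ c)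
    (hd : d ≤ B.d) : S.FlowBox where
  toFun := B.toFun
  a := a
  b := b
  c := c
  d := d
  a_lt_b := hab
  c_lt_d := hcd
  closedLeft := B.closedLeft ∧ B.a = a
  closedRight := B.closedRight ∧ b = B.b
  continuousOn := B.continuousOn.mono <| by
    rintro z ⟨h₁, h₂, h₃, h₄⟩
    exact ⟨h₁.elim (fun h => Or.inl (ha.trans_lt h)) fun h => Or.inr ⟨h.1.1, h.1.2.trans h.2⟩,
      h₂.elim (fun h => Or.inl (h.trans_le hb)) fun h => Or.inr ⟨h.1.1, h.2.trans h.1.2⟩,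
      hc.trans_lt h₃, h₄.trans_le hd⟩
  injOn := B.injOn.mono <| by
    rintro z ⟨h₁, h₂, h₃, h₄⟩
    exact ⟨ha.trans_lt h₁, h₂.trans_le hb, hc.trans_lt h₃, h₄.trans_le hd⟩
  notMem_sing z h₁ h₂ h₃ h₄ :=
    B.notMem_sing z (ha.trans_lt h₁) (h₂.trans_le hb) (hc.trans_lt h₃) (h₄.trans_le hd)
  translation z h₁ h₂ h₃ h₄ :=
    B.translation z (ha.trans_lt h₁) (h₂.trans_le hb) (hc.trans_lt h₃) (h₄.trans_le hd)

/-- Near a point of an edge the rectangle coincides with a half-plane. Shrinking a flow box around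
an edge point therefore leaves the germ unchanged. -/
lemma nhdsWithin_interior {s : Side} {z : ℂ} (hz : z ∈ B.edge s) :
    𝓝[B.interior] z = 𝓝[halfPlane s z] z := by
  have hab := B.a_lt_b
  rw [nhdsWithin_eq_iff_eventuallyEq]
  have h₁ : ∀ᶠ w : ℂ in 𝓝 z, B.c < w.im ∧ w.im < B.d := by
    have : B.c < z.im ∧ z.im < B.d := by cases s <;> exact hz.2.2
    exact (Complex.continuous_im.continuousAt.eventually (lt_mem_nhds this.1)).and
      (Complex.continuous_im.continuousAt.eventually (gt_mem_nhds this.2))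
  cases s
  · have h₂ : ∀ᶠ w : ℂ in 𝓝 z, B.a < w.re :=
      Complex.continuous_re.continuousAt.eventually (lt_mem_nhds (by rwa [hz.2.1]))
    filter_upwards [h₁, h₂] with w h₁ h₂
    exact propext ⟨fun h => show w.re < z.re from hz.2.1 ▸ h.2.1,
      fun h => ⟨h₂, (show w.re < z.re from h).trans_eq hz.2.1, h₁⟩⟩
  · have h₂ : ∀ᶠ w : ℂ in 𝓝 z, w.re < B.b :=
      Complex.continuous_re.continuousAt.eventually (gt_mem_nhds (by rwa [hz.2.1]))
    filter_upwards [h₁, h₂] with w h₁ h₂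
    exact propext ⟨fun h => show z.re < w.re from hz.2.1 ▸ h.1,
      fun h => ⟨hz.2.1.symm.trans_lt (show z.re < w.re from h), h₂, h₁⟩⟩

/-- `B'` is the half of the square of size `ε` at the point `z` of an edge of `B`. -/
structure IsEdgeBox (s : Side) (z : ℂ) (ε : ℝ) (B' : S.FlowBox) : Prop where
  toFun_eq : B'.toFun = B.toFun
  interior_eq : B'.interior = halfPlane s z ∩ square z ε
  edge_eq : B'.edge s = {w | w.re = z.re ∧ |w.im - z.im| < ε}
  edge_ne : ∀ s' ≠ s, B'.edge s' = ∅

lemma exists_isEdgeBox {s : Side} {z : ℂ} (hz : z ∈ B.edge s) :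
    ∃ ε₀ > 0, ∀ ε, 0 < ε → ε < ε₀ → ∃ B', B.IsEdgeBox s z ε B' ∧ B'.interior ⊆ B.interior ∧
      B'.edge s ⊆ B.edge s := by
  have hab := B.a_lt_b
  obtain ⟨h₁, h₂⟩ : B.c < z.im ∧ z.im < B.d := by cases s <;> exact hz.2.2
  -- The width of `B` and the distances from `z` to the ends of its edge. Since `ε` is strictly
  -- below the width, the far edge of the half-square is interior to `B`, and `restrict` leaves it
  -- out.
  refine ⟨min (B.b - B.a) (min (z.im - B.c) (B.d - z.im)), by simp [hab, h₁, h₂],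
    fun ε hε hε₀ => ?_⟩
  rw [lt_min_iff, lt_min_iff] at hε₀
  obtain ⟨hε₁, hε₂, hε₃⟩ := hε₀
  cases s with
  | left =>
    obtain ⟨hz₁, hz₂, -⟩ := hz
    refine ⟨B.restrict (z.re - ε) z.re (z.im - ε) (z.im + ε) (by linarith) (by linarith)
      (by linarith) (by linarith) (by linarith) (by linarith), ⟨rfl, ?_, ?_, ?_⟩, ?_, ?_⟩
    · ext w
      simp only [interior, restrict, halfPlane, square, abs_lt, Set.mem_inter_iff,
        Set.mem_ofPred_eq]
      constructor
      · rintro ⟨_, _, _, _⟩; refine ⟨?_, ⟨?_, ?_⟩, ?_, ?_⟩ <;> linarith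
      · rintro ⟨_, ⟨_, _⟩, _, _⟩; refine ⟨?_, ?_, ?_, ?_⟩ <;> linarith
    · ext w
      simp only [edge, restrict, abs_lt, Set.mem_ofPred_eq]
      constructor
      · rintro ⟨_, _, _, _⟩; refine ⟨?_, ?_, ?_⟩ <;> linarith
      · rintro ⟨_, _, _⟩; refine ⟨⟨hz₁, hz₂⟩, ?_, ?_, ?_⟩ <;> linarith
    · intro s' hs'
      cases s'
      · exact absurd rfl hs'
      · ext w
        simp only [edge, restrict, Set.mem_ofPred_eq, Set.mem_empty_iff_false, iff_false]
        rintro ⟨⟨_, _⟩, _⟩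
        linarith
    · rintro w ⟨_, _, _, _⟩
      simp only [restrict] at *
      refine ⟨?_, ?_, ?_, ?_⟩ <;> linarith
    · rintro w ⟨_, _, _, _⟩
      simp only [restrict] at *
      refine ⟨hz₁, ?_, ?_, ?_⟩ <;> linarith
  | right =>
    obtain ⟨hz₁, hz₂, -⟩ := hz
    refine ⟨B.restrict z.re (z.re + ε) (z.im - ε) (z.im + ε) (by linarith) (by linarith)
      (by linarith) (by linarith) (by linarith) (by linarith), ⟨rfl, ?_, ?_, ?_⟩, ?_, ?_⟩
    · ext w
      simp only [interior, restrict, halfPlane, square, abs_lt, Set.mem_inter_iff,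
        Set.mem_ofPred_eq]
      constructor
      · rintro ⟨_, _, _, _⟩; refine ⟨?_, ⟨?_, ?_⟩, ?_, ?_⟩ <;> linarith
      · rintro ⟨_, ⟨_, _⟩, _, _⟩; refine ⟨?_, ?_, ?_, ?_⟩ <;> linarith
    · ext w
      simp only [edge, restrict, abs_lt, Set.mem_ofPred_eq]
      constructor
      · rintro ⟨_, _, _, _⟩; refine ⟨?_, ?_, ?_⟩ <;> linarith
      · rintro ⟨_, _, _⟩; refine ⟨⟨hz₁, hz₂.symm⟩, ?_, ?_, ?_⟩ <;> linarith
    · intro s' hs'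
      cases s'
      · ext w
        simp only [edge, restrict, Set.mem_ofPred_eq, Set.mem_empty_iff_false, iff_false]
        rintro ⟨⟨_, _⟩, _⟩
        linarith
      · exact absurd rfl hs'
    · rintro w ⟨_, _, _, _⟩
      simp only [restrict] at *
      refine ⟨?_, ?_, ?_, ?_⟩ <;> linarith
    · rintro w ⟨_, _, _, _⟩
      simp only [restrict] at *
      refine ⟨hz₁, ?_, ?_, ?_⟩ <;> linarith

/-! ### Comparison of overlapping flow boxes -/

/-- Two flow boxes that meet differ by a translation. -/
lemma eventually_eq_of_eq {B B' : S.FlowBox} {w w' : ℂ} (hw : w ∈ B.interior)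
    (hw' : w' ∈ B'.interior) (h : B.toFun w = B'.toFun w') :
    ∀ᶠ v in 𝓝 w, B.toFun v = B'.toFun (v + (w' - w)) := by
  obtain ⟨e, he, hpe⟩ := S.covers _ (B.toFun_notMem_sing hw)
  have hpe' : B'.toFun w' ∈ e.source := h ▸ hpe
  have ht := B.translation w hw.1 hw.2.1 hw.2.2.1 hw.2.2.2 e he hpe
  have ht' := B'.translation w' hw'.1 hw'.2.1 hw'.2.2.1 hw'.2.2.2 e he hpe'
  have hlim : Tendsto (fun v => v + (w' - w)) (𝓝 w) (𝓝 w') := by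
    have : Tendsto (fun v => v + (w' - w)) (𝓝 w) (𝓝 (w + (w' - w))) :=
      (continuous_id.add continuous_const).tendsto w
    simpa using this
  have hs := (B.continuousAt hw).eventually (e.open_source.mem_nhds hpe)
  have hs' := (B'.continuousAt hw').eventually (e.open_source.mem_nhds hpe')
  filter_upwards [ht, hlim.eventually ht', hs, hlim.eventually hs'] with v h₁ h₂ h₃ h₄
  refine e.injOn h₃ h₄ ?_
  rw [h₁, h₂, h]
  ring

/-- Two flow boxes with the same germ of half-disk along an edge differ by a translation near it. -/
lemma exists_translation_of_germ_eq {B B' : S.FlowBox} {s : Side} {z z' : ℂ} (hz : z ∈ B.edge s)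
    (h : map B.toFun (𝓝[B.interior] z) = map B'.toFun (𝓝[B'.interior] z')) :
    ∃ δ > 0, ∀ w ∈ halfPlane s z ∩ square z δ,
      w + (z' - z) ∈ B'.interior ∧ B.toFun w = B'.toFun (w + (z' - z)) := by
  -- Equality of the two germs says that each `w` close to `z` in the half-plane has a partner `w'`
  -- in `B'` with the same image, and that `w'` can be taken close to `z'`.
  have hnhds (N : Set ℂ) (hN : N ∈ 𝓝 z') : ∀ᶠ w in 𝓝[halfPlane s z] z,
      w ∈ B.interior ∧ ∃ w' ∈ B'.interior, w' ∈ N ∧ B'.toFun w' = B.toFun w := by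
    rw [← B.nhdsWithin_interior hz]
    refine (eventually_mem_nhdsWithin).and ?_
    have : B'.toFun '' (B'.interior ∩ N) ∈ map B.toFun (𝓝[B.interior] z) := by
      rw [h]
      exact image_mem_map (inter_mem self_mem_nhdsWithin (mem_nhdsWithin_of_mem_nhds hN))
    filter_upwards [this] with w ⟨w', hw', e⟩
    exact ⟨w', hw'.1, hw'.2, e⟩
  obtain ⟨δ, hδ, H⟩ := exists_square_of_eventually (hnhds Set.univ univ_mem)
  have hex (w : ℂ) : ∃ w', w ∈ halfPlane s z ∩ square z δ →
      w' ∈ B'.interior ∧ B'.toFun w' = B.toFun w := by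
    by_cases hw : w ∈ halfPlane s z ∩ square z δ
    · obtain ⟨w', h₁, -, h₂⟩ := (H w hw).2
      exact ⟨w', fun _ => ⟨h₁, h₂⟩⟩
    · exact ⟨0, fun h => absurd h hw⟩
  choose σ hσ using hex
  -- `B'` is injective, so the chosen partner `σ w` is the one that is close to `z'`.
  have hlim : Tendsto σ (𝓝[halfPlane s z] z) (𝓝 z') := by
    refine tendsto_def.2 fun N hN => ?_
    filter_upwards [hnhds N hN, self_mem_nhdsWithin,
      mem_nhdsWithin_of_mem_nhds ((isOpen_square z δ).mem_nhds (mem_square_self z hδ))]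
      with w ⟨_, w', h₁, h₂, h₃⟩ h₄ h₅
    obtain ⟨h₆, h₇⟩ := hσ w ⟨h₄, h₅⟩
    rwa [Set.mem_preimage, B'.injOn_interior h₆ h₁ (h₇.trans h₃.symm)]
  -- `σ w - w` is locally constant by `eventually_eq_of_eq`, hence constant on the convex
  -- half-square; letting `w` tend to `z` then identifies the constant as `z' - z`.
  have hconst : ∀ x ∈ halfPlane s z ∩ square z δ, ∀ y ∈ halfPlane s z ∩ square z δ,
      σ x - x = σ y - y := by
    intro x hx y hy
    refine (convex_halfPlane_inter_square s z δ).isPreconnected.induction₂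
      (fun x y => σ x - x = σ y - y) (fun w hw => ?_) (fun _ _ _ _ _ _ => Eq.trans)
      (fun _ _ _ _ => Eq.symm) hx hy
    obtain ⟨h₁, h₂⟩ := hσ w hw
    have hlim : Tendsto (fun v => v + (σ w - w)) (𝓝 w) (𝓝 (σ w)) := by
      have : Tendsto (fun v => v + (σ w - w)) (𝓝 w) (𝓝 (w + (σ w - w))) :=
        (continuous_id.add continuous_const).tendsto w
      simpa using this
    filter_upwards [self_mem_nhdsWithin,
      mem_nhdsWithin_of_mem_nhds (eventually_eq_of_eq (H w hw).1 h₁ h₂.symm),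
      mem_nhdsWithin_of_mem_nhds (hlim.eventually (B'.isOpen_interior.mem_nhds h₁))]
      with v h₃ h₄ h₅
    have := B'.injOn_interior (hσ v h₃).1 h₅ ((hσ v h₃).2.trans h₄)
    rw [this]
    ring
  obtain ⟨x, hx⟩ := halfPlane_inter_square_nonempty s z hδ
  have hz' : z' = z + (σ x - x) := by
    refine tendsto_nhds_unique_of_eventuallyEq hlim
      (((continuous_id.add continuous_const).tendsto z).mono_left nhdsWithin_le_nhds) ?_
    filter_upwards [self_mem_nhdsWithin,
      mem_nhdsWithin_of_mem_nhds ((isOpen_square z δ).mem_nhds (mem_square_self z hδ))]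
      with w h₁ h₂
    rw [hconst x hx w ⟨h₁, h₂⟩]
    simp
  refine ⟨δ, hδ, fun w hw => ?_⟩
  have e : w + (z' - z) = σ w := by rw [hz', hconst x hx w hw]; ring
  rw [e]
  exact ⟨(hσ w hw).1, (hσ w hw).2.symm⟩

end FlowBox

end TranslationSurface

/-! ### The topology of the divided surface -/

namespace TranslationSurface

variable {X : Type u} [TopologicalSpace X] {S : TranslationSurface X}

/-- The edges of a flow box contribute only lane points, so a generator that contains `ι p` contains
a whole preimage of a neighborhood of `p`. Finite intersections and unions keep this property. -/
lemma exists_preimage_subset {U : Set S.Divided} (hU : IsOpen U) {p : X} {hp : p ∉ S.sing}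
    (h : .point p hp ∈ U) : ∃ V : Set X, IsOpen V ∧ p ∈ V ∧ S.projFun ⁻¹' V ⊆ U := by
  induction hU with
  | basic s hs =>
    obtain ⟨V, hV, rfl⟩ | ⟨B, rfl⟩ := hs
    · exact ⟨V, hV, h, subset_rfl⟩
    · obtain h | ⟨l, hl, -⟩ := h
      · exact ⟨_, B.isOpen_image_interior, h, Set.subset_union_left⟩
      · cases hl
  | univ => exact ⟨Set.univ, isOpen_univ, trivial, Set.subset_univ _⟩
  | inter s t _ _ hs ht =>
    obtain ⟨V, hV, hpV, h₁⟩ := hs h.1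
    obtain ⟨W, hW, hpW, h₂⟩ := ht h.2
    exact ⟨V ∩ W, hV.inter hW, ⟨hpV, hpW⟩, fun x hx => ⟨h₁ hx.1, h₂ hx.2⟩⟩
  | sUnion 𝒰 _ ih =>
    obtain ⟨s, hs, h⟩ := h
    obtain ⟨V, hV, hpV, h₁⟩ := ih s hs h
    exact ⟨V, hV, hpV, h₁.trans (Set.subset_sUnion_of_mem hs)⟩

/-- Continuity of the flow box map up to the edge. -/
lemma dividedBox_subset_preimage {B : S.FlowBox} {s : Side} {z : ℂ} (hz : z ∈ B.edge s)
    {V : Set X} (hV : IsOpen V) (hzV : B.toFun z ∈ V) :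
    ∃ ε₀ > 0, ∀ ε B', ε < ε₀ → B.IsEdgeBox s z ε B' → B'.interior ⊆ B.interior →
      B'.edge s ⊆ B.edge s → S.dividedBox B' ⊆ S.projFun ⁻¹' V := by
  have hc := (B.continuousOn_domain z (B.edge_subset_domain s hz)).eventually (hV.mem_nhds hzV)
  obtain ⟨ε₀, hε₀, h⟩ := ((hasBasis_square z).inf_principal _).eventually_iff.1 hc
  refine ⟨ε₀, hε₀, fun ε B' hε hB' hint hedge => ?_⟩
  rintro x (⟨w, hw, e⟩ | ⟨l, rfl, w, hw, e, -⟩)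
  · rw [Set.mem_preimage, ← e, hB'.toFun_eq]
    refine h ⟨square_mono z hε.le ?_, B.interior_subset_domain (hint hw)⟩
    rw [hB'.interior_eq] at hw
    exact hw.2
  · have hs : l.side = s := by
      by_contra hs
      rw [hB'.edge_ne _ hs] at hw
      exact hw
    rw [hs] at hw
    change l.base ∈ V
    rw [← e, hB'.toFun_eq]
    refine h ⟨?_, B.edge_subset_domain s (hedge hw)⟩
    rw [hB'.edge_eq] at hw
    exact ⟨by rw [hw.1]; simpa using hε₀, hw.2.trans hε⟩

/-- Near a common lane point the two boxes differ by a translation. It carries the interior of a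
small half-square of `B` into `B₂`, and also the lane points on its edge, together with their germs.
-/
lemma dividedBox_subset_dividedBox [T2Space X] {B B₂ : S.FlowBox} {s : Side} {z z₂ : ℂ}
    (hz : z ∈ B.edge s) (hz₂ : z₂ ∈ B₂.edge s)
    (hg : map B.toFun (𝓝[B.interior] z) = map B₂.toFun (𝓝[B₂.interior] z₂)) :
    ∃ ε₀ > 0, ∀ ε B', ε < ε₀ → B.IsEdgeBox s z ε B' → B'.interior ⊆ B.interior →
      B'.edge s ⊆ B.edge s → S.dividedBox B' ⊆ S.dividedBox B₂ := by
  obtain ⟨δ, hδ, H⟩ := FlowBox.exists_translation_of_germ_eq hz hg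
  obtain ⟨ε₁, hε₁, H₁⟩ := B₂.exists_isEdgeBox hz₂
  refine ⟨min δ ε₁, lt_min hδ hε₁, fun ε B' hε hB' hint hedge => ?_⟩
  rw [lt_min_iff] at hε
  rintro x (⟨w, hw, e⟩ | ⟨l, rfl, w, hw, e, hlg⟩)
  · rw [hB'.interior_eq] at hw
    obtain ⟨h₁, h₂⟩ := H w ⟨hw.1, square_mono z hε.1.le hw.2⟩
    exact Or.inl ⟨_, h₁, by rw [← h₂, ← e, hB'.toFun_eq]⟩
  · have hs : l.side = s := by
      by_contra hs
      rw [hB'.edge_ne _ hs] at hw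
      exact hw
    rw [hs] at hw
    have hwB := hedge hw
    have hwn := B'.nhdsWithin_interior hw
    rw [hB'.edge_eq] at hw
    have hε0 : 0 < ε := (abs_nonneg _).trans_lt hw.2
    have hw₂ : w + (z₂ - z) ∈ B₂.edge s := by
      obtain ⟨B₃, hB₃, -, h₃⟩ := H₁ ε hε0 hε.2
      refine h₃ ?_
      rw [hB₃.edge_eq]
      exact ⟨by simp [hw.1], by
        have : (w + (z₂ - z)).im - z₂.im = w.im - z.im := by simp; ring
        rw [this]
        exact hw.2⟩
    have hhalf : halfPlane s w = halfPlane s z := by cases s <;> simp only [halfPlane, hw.1]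
    have hev : ∀ᶠ v in 𝓝[halfPlane s w] w, B.toFun v = B₂.toFun (v + (z₂ - z)) := by
      have : w ∈ square z δ := ⟨by rw [hw.1]; simpa using hδ, hw.2.trans hε.1⟩
      filter_upwards [self_mem_nhdsWithin,
        mem_nhdsWithin_of_mem_nhds ((isOpen_square z δ).mem_nhds this)] with v h₁ h₂
      exact (H v ⟨hhalf ▸ h₁, h₂⟩).2
    have hmap := map_add_right_nhdsWithin_halfPlane s w (z₂ - z)
    rw [← B₂.nhdsWithin_interior hw₂] at hmap
    -- On the half-plane the two maps agree; at the edge their values are limits of these, and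
    -- limits in a Hausdorff space are unique.
    have hBw : B.toFun w = B₂.toFun (w + (z₂ - z)) := by
      have h₁ : Tendsto B.toFun (𝓝[halfPlane s w] w) (𝓝 (B.toFun w)) := by
        rw [← B.nhdsWithin_interior hwB]
        exact (B.continuousOn_domain w (B.edge_subset_domain s hwB)).mono_left
          (nhdsWithin_mono _ B.interior_subset_domain)
      have h₂ : Tendsto B₂.toFun (𝓝[B₂.interior] (w + (z₂ - z)))
          (𝓝 (B₂.toFun (w + (z₂ - z)))) :=
        (B₂.continuousOn_domain _ (B₂.edge_subset_domain s hw₂)).mono_left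
          (nhdsWithin_mono _ B₂.interior_subset_domain)
      rw [← hmap, tendsto_map'_iff] at h₂
      exact tendsto_nhds_unique_of_eventuallyEq h₁ h₂ hev
    refine Or.inr ⟨l, rfl, w + (z₂ - z), hs ▸ hw₂, ?_, ?_⟩
    · rw [← hBw, ← e, hB'.toFun_eq]
    · rw [hlg, hB'.toFun_eq, hwn, ← hmap, map_map]
      exact map_congr hev

/-- The small halves of squares are a basis of neighborhoods of a lane point. -/
lemma exists_dividedBox_subset [T2Space X] {U : Set S.Divided} (hU : IsOpen U) {l : S.Lane}
    (hl : .lane l ∈ U) {B : S.FlowBox} {z : ℂ} (hz : z ∈ B.edge l.side)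
    (hb : B.toFun z = l.base) (hg : l.germ = map B.toFun (𝓝[B.interior] z)) :
    ∃ ε₀ > 0, ∀ ε B', ε < ε₀ → B.IsEdgeBox l.side z ε B' → B'.interior ⊆ B.interior →
      B'.edge l.side ⊆ B.edge l.side → S.dividedBox B' ⊆ U := by
  induction hU with
  | basic s hs =>
    obtain ⟨V, hV, rfl⟩ | ⟨B₂, rfl⟩ := hs
    · exact dividedBox_subset_preimage hz hV (hb ▸ hl)
    · obtain h | ⟨l', hl', z₂, hz₂, hb₂, hg₂⟩ := hl
      -- The lane point may also lie over the open rectangle of `B₂`, away from its edges.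
      · obtain ⟨ε₀, hε₀, h⟩ := dividedBox_subset_preimage hz B₂.isOpen_image_interior
          (hb ▸ (show l.base ∈ B₂.toFun '' B₂.interior from h))
        exact ⟨ε₀, hε₀, fun ε B' h₁ h₂ h₃ h₄ => (h ε B' h₁ h₂ h₃ h₄).trans Set.subset_union_left⟩
      · obtain rfl : l = l' := by simpa using hl'
        exact dividedBox_subset_dividedBox hz hz₂ (hg.symm.trans hg₂)
  | univ => exact ⟨1, one_pos, fun _ _ _ _ _ _ => Set.subset_univ _⟩
  | inter s t _ _ hs ht =>
    obtain ⟨ε₁, hε₁, h₁⟩ := hs hl.1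
    obtain ⟨ε₂, hε₂, h₂⟩ := ht hl.2
    refine ⟨min ε₁ ε₂, lt_min hε₁ hε₂, fun ε B' hε h₃ h₄ h₅ => ?_⟩
    rw [lt_min_iff] at hε
    exact Set.subset_inter (h₁ ε B' hε.1 h₃ h₄ h₅) (h₂ ε B' hε.2 h₃ h₄ h₅)
  | sUnion 𝒰 _ ih =>
    obtain ⟨s, hs, h⟩ := hl
    obtain ⟨ε₀, hε₀, h⟩ := ih s hs h
    exact ⟨ε₀, hε₀, fun ε B' h₁ h₂ h₃ h₄ =>
      (h ε B' h₁ h₂ h₃ h₄).trans (Set.subset_sUnion_of_mem hs)⟩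

/-! ### Passage of open sets between the two surfaces -/

/-- The trace of an open set of the divided surface on the surface minus its singularities. -/
abbrev shadow (U : Opens S.dividedTop) : Opens S.puncturedTop := (Opens.map S.emb).obj U

/-- The part of the divided surface over an open set of the surface minus its singularities. -/
abbrev above (V : Opens S.puncturedTop) : Opens S.dividedTop :=
  (Opens.map S.proj).obj (S.isOpenEmbedding_incl.functor.obj V)

lemma shadow_above (V : Opens S.puncturedTop) : shadow (above V) = V := by
  ext p
  change (∃ q ∈ V, q.1 = p.1) ↔ p ∈ V
  exact ⟨fun ⟨q, hq, e⟩ => Subtype.ext e ▸ hq, fun h => ⟨p, h, rfl⟩⟩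

lemma above_mono {V W : Opens S.puncturedTop} (h : V ≤ W) : above V ≤ above W :=
  fun _ ⟨p, hp, e⟩ => ⟨p, h hp, e⟩

lemma shadow_mono {U W : Opens S.dividedTop} (h : U ≤ W) : shadow U ≤ shadow W :=
  fun _ hp => h hp

lemma above_shadow_le (U : Opens S.dividedTop) : above (shadow U) ≤ U := by
  rintro x ⟨p, hp, e⟩
  obtain ⟨V, -, hpV, h⟩ := exists_preimage_subset (p := p.1) (hp := p.2) U.2 hp
  have e' : p.1 = S.projFun x := e
  exact h (show S.projFun x ∈ V from e' ▸ hpV)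

lemma embFun_mem_above {V : Opens S.puncturedTop} {p : S.puncturedTop} (hp : p ∈ V) :
    S.embFun p ∈ above V := ⟨p, hp, rfl⟩

lemma isConnected_preimage_val {W : Set X} (hW : W ⊆ S.singᶜ) (hWc : IsConnected W) :
    IsConnected (Subtype.val ⁻¹' W : Set S.puncturedTop) := by
  have h : Subtype.val '' (Subtype.val ⁻¹' W : Set (S.singᶜ : Set X)) = W := by
    rw [Set.image_preimage_eq_iff, Subtype.range_coe]
    exact hW
  refine ⟨?_, (IsInducing.subtypeVal.isPreconnected_image).1 (h.symm ▸ hWc.isPreconnected)⟩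
  obtain ⟨p, hp⟩ := hWc.nonempty
  exact ⟨⟨p, hW hp⟩, hp⟩

lemma isConnected_image_interior (B : S.FlowBox) : IsConnected (B.toFun '' B.interior) :=
  ⟨B.interior_nonempty.image _, B.convex_interior.isPreconnected.image _
    (B.continuousOn_domain.mono B.interior_subset_domain)⟩

lemma image_interior_subset (B : S.FlowBox) : B.toFun '' B.interior ⊆ S.singᶜ := by
  rintro _ ⟨z, hz, rfl⟩
  exact B.toFun_notMem_sing hz

/-- The open rectangle of a flow box, in the surface minus its singularities. -/
def box (B : S.FlowBox) : Opens S.puncturedTop :=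
  ⟨Subtype.val ⁻¹' (B.toFun '' B.interior), B.isOpen_image_interior.preimage continuous_subtype_val⟩

lemma isConnected_box (B : S.FlowBox) : IsConnected (box B : Set S.puncturedTop) :=
  isConnected_preimage_val (image_interior_subset B) (isConnected_image_interior B)

/-- Lane points have no trace. With `above_box` this makes trimming an instance of `above (shadow
U)`. -/
lemma shadow_flowBox (B : S.FlowBox) : shadow (S.flowBox B) = box B := by
  ext p
  change (S.embFun p ∈ S.dividedBox B) ↔ (p : X) ∈ B.toFun '' B.interior
  simp [embFun, dividedBox, trimmedBox, projFun]

lemma above_box (B : S.FlowBox) : above (box B) = S.trim B := by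
  ext x
  change (∃ p : (S.singᶜ : Set X), p.1 ∈ B.toFun '' B.interior ∧ (p : X) = S.projFun x) ↔
    S.projFun x ∈ B.toFun '' B.interior
  exact ⟨fun ⟨p, hp, e⟩ => e ▸ hp, fun h => ⟨⟨_, image_interior_subset B h⟩, h, rfl⟩⟩

lemma exists_connected_subset {p : X} (hp : p ∉ S.sing) {V : Set X} (hV : IsOpen V)
    (hpV : p ∈ V) : ∃ W ⊆ V, IsOpen W ∧ p ∈ W ∧ W ⊆ S.singᶜ ∧ IsConnected W := by
  obtain ⟨e, he, hpe⟩ := S.covers p hp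
  have ho : IsOpen (e.symm ⁻¹' V ∩ e.target) := by
    rw [Set.inter_comm]
    exact e.isOpen_inter_preimage_symm hV
  obtain ⟨r, hr, h⟩ := Metric.isOpen_iff.1 ho (e p) ⟨by simpa [hpe] using hpV, e.map_source hpe⟩
  refine ⟨e.symm '' Metric.ball (e p) r, ?_, ?_, ⟨e p, Metric.mem_ball_self hr, e.left_inv hpe⟩,
    ?_, ?_⟩
  · rintro _ ⟨z, hz, rfl⟩
    exact (h hz).1
  · exact e.symm.isOpen_image_of_subset_source Metric.isOpen_ball fun z hz => (h hz).2
  · rintro _ ⟨z, hz, rfl⟩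
    exact S.source_subset e he (e.map_target (h hz).2)
  · exact ⟨(Metric.nonempty_ball.2 hr).image _, (convex_ball _ _).isPreconnected.image _
      (e.continuousOn_symm.mono fun z hz => (h hz).2)⟩

instance : LocallyConnectedSpace S.puncturedTop :=
  locallyConnectedSpace_iff_subsets_isOpen_isConnected.2 fun p U hU => by
    obtain ⟨O, hOU, hO, hp⟩ := mem_nhds_iff.1 hU
    obtain ⟨V, hV, rfl⟩ := isOpen_induced_iff.1 hO
    obtain ⟨W, hWV, hW, hpW, hWs, hWc⟩ := exists_connected_subset p.2 hV hp
    exact ⟨Subtype.val ⁻¹' W, (Set.preimage_mono hWV).trans hOU,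
      hW.preimage continuous_subtype_val, hpW, isConnected_preimage_val hWs hWc⟩

/-! ### Connectedness of traces and saturations -/

variable [T2Space X]

/-- The divided surface has a basis of open sets with connected trace. -/
lemma exists_connected_shadow (U : Opens S.dividedTop) {y : S.dividedTop} (hy : y ∈ U) :
    ∃ N ≤ U, y ∈ N ∧ IsConnected (shadow N : Set S.puncturedTop) := by
  obtain ⟨p, hp⟩ | l := y
  · obtain ⟨V, hV, hpV, h⟩ := exists_preimage_subset U.2 hy
    obtain ⟨W, hWV, hW, hpW, hWs, hWc⟩ := exists_connected_subset hp hV hpV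
    exact ⟨⟨S.projFun ⁻¹' W, hW.preimage S.continuous_projFun⟩,
      (Set.preimage_mono hWV).trans h, hpW, isConnected_preimage_val hWs hWc⟩
  · obtain ⟨B, z, hz, hb, hg⟩ := l.exists_box
    obtain ⟨ε₀, hε₀, h⟩ := exists_dividedBox_subset U.2 hy hz hb hg
    obtain ⟨ε₁, hε₁, h₁⟩ := B.exists_isEdgeBox hz
    obtain ⟨ε, hε, hlt⟩ := exists_between (lt_min hε₀ hε₁)
    rw [lt_min_iff] at hlt
    obtain ⟨B', hB', hint, hedge⟩ := h₁ ε hε hlt.2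
    have hz' : z ∈ B'.edge l.side := by
      rw [hB'.edge_eq]
      exact ⟨rfl, by simpa using hε⟩
    refine ⟨S.flowBox B', h ε B' hlt.1 hB' hint hedge,
      Or.inr ⟨l, rfl, z, hz', by rw [hB'.toFun_eq, hb], ?_⟩, ?_⟩
    · rw [hg, hB'.toFun_eq, B.nhdsWithin_interior hz, B'.nhdsWithin_interior hz']
    · rw [shadow_flowBox]
      exact isConnected_box B'

/-- The image `ι V` is connected, and it is dense in `above V` because every non-empty open set has
a non-empty trace. -/
lemma isConnected_above {V : Opens S.puncturedTop} (hV : IsConnected (V : Set S.puncturedTop)) :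
    IsConnected (above V : Set S.dividedTop) := by
  refine (hV.image _ S.continuous_embFun.continuousOn).subset_closure
    (Set.image_subset_iff.2 fun p hp => embFun_mem_above hp) fun x hx => ?_
  refine mem_closure_iff.2 fun O hO hxO => ?_
  obtain ⟨N, hN, -, ⟨p, hp⟩, -⟩ := exists_connected_shadow (⟨O, hO⟩ ⊓ above V) (y := x) ⟨hxO, hx⟩
  have hpN := hN hp
  refine ⟨S.embFun p, hpN.1, p, ?_, rfl⟩
  rw [← shadow_above V]
  exact hpN.2

/-- Density of `ι` is not enough here: removing the lane points must not separate `W` even locally.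
As small neighborhoods have connected traces, a separation of the trace would extend to a separation
of `W`. -/
lemma isConnected_shadow {W : Opens S.dividedTop} (hW : IsConnected (W : Set S.dividedTop)) :
    IsConnected (shadow W : Set S.puncturedTop) := by
  constructor
  · obtain ⟨x, hx⟩ := hW.nonempty
    obtain ⟨N, hN, -, ⟨p, hp⟩, -⟩ := exists_connected_shadow W hx
    exact ⟨p, hN hp⟩
  intro O₁ O₂ hO₁ hO₂ hcov ⟨p₁, hp₁, hp₁'⟩ ⟨p₂, hp₂, hp₂'⟩
  by_contra hne
  -- `A O` is the largest open set whose trace within `W` lies in `O`. A point of `W` in both `A O₁`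
  -- and `A O₂` has a neighborhood with non-empty trace in `O₁ ∩ O₂`.
  let A (O : Set S.puncturedTop) : Set S.dividedTop :=
    ⋃ N ∈ {N : Opens S.dividedTop | ∀ p ∈ shadow (N ⊓ W), p ∈ O}, (N : Set S.dividedTop)
  have hA (O) : IsOpen (A O) := isOpen_biUnion fun N _ => N.2
  have hmem {O : Set S.puncturedTop} (hO : IsOpen O) {p : S.puncturedTop} (hp : p ∈ O) :
      S.embFun p ∈ A O := by
    refine Set.mem_biUnion (x := above ⟨O, hO⟩) (fun q hq => ?_) (embFun_mem_above hp)
    have : q ∈ shadow (above ⟨O, hO⟩) := hq.1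
    rwa [shadow_above] at this
  obtain ⟨x, hxW, hx₁, hx₂⟩ := hW.isPreconnected (A O₁) (A O₂) (hA O₁) (hA O₂) (fun x hx => by
    obtain ⟨N, hN, hxN, hNc⟩ := exists_connected_shadow W hx
    have hN' := shadow_mono hN
    obtain h | h := hNc.isPreconnected.subset_or_subset (hO₁.inter (shadow W).2)
      (hO₂.inter (shadow W).2) (Set.disjoint_left.2 fun q h₁ h₂ => hne ⟨q, h₁.2, h₁.1, h₂.1⟩)
      (fun q hq => (hcov (hN' hq)).imp (fun h => ⟨h, hN' hq⟩) fun h => ⟨h, hN' hq⟩)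
    · exact Or.inl (Set.mem_biUnion (x := N) (fun q hq => (h hq.1).1) hxN)
    · exact Or.inr (Set.mem_biUnion (x := N) (fun q hq => (h hq.1).1) hxN))
    ⟨_, hp₁, hmem hO₁ hp₁'⟩ ⟨_, hp₂, hmem hO₂ hp₂'⟩
  obtain ⟨N₁, hN₁, hxN₁⟩ := Set.mem_iUnion₂.1 hx₁
  obtain ⟨N₂, hN₂, hxN₂⟩ := Set.mem_iUnion₂.1 hx₂
  obtain ⟨N, hN, -, ⟨p, hp⟩, -⟩ := exists_connected_shadow (N₁ ⊓ N₂ ⊓ W) (y := x)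
    ⟨⟨hxN₁, hxN₂⟩, hxW⟩
  have hp' := hN hp
  exact hne ⟨p, hp'.2, hN₁ p ⟨hp'.1.1, hp'.2⟩, hN₂ p ⟨hp'.1.2, hp'.2⟩⟩

/-- `N` lies between the connected set `above (shadow N)` and its closure. -/
lemma isConnected_of_shadow {N : Opens S.dividedTop}
    (hN : IsConnected (shadow N : Set S.puncturedTop)) : IsConnected (N : Set S.dividedTop) := by
  refine (isConnected_above hN).subset_closure (above_shadow_le N) fun x hx => ?_
  refine mem_closure_iff.2 fun O hO hxO => ?_
  obtain ⟨M, hM, -, ⟨p, hp⟩, -⟩ := exists_connected_shadow (⟨O, hO⟩ ⊓ N) (y := x) ⟨hxO, hx⟩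
  have hpM := hM hp
  exact ⟨S.embFun p, hpM.1, embFun_mem_above hpM.2⟩

instance : LocallyConnectedSpace S.dividedTop :=
  locallyConnectedSpace_iff_subsets_isOpen_isConnected.2 fun y U hU => by
    obtain ⟨O, hOU, hO, hy⟩ := mem_nhds_iff.1 hU
    obtain ⟨N, hN, hyN, hNc⟩ := exists_connected_shadow ⟨O, hO⟩ (y := y) hy
    exact ⟨N, Set.Subset.trans hN hOU, N.2, hyN, isConnected_of_shadow hNc⟩

end TranslationSurface

/-! ### Locally constant sheaves on a rectangle -/

namespace TranslationSurface

/-- The open rectangle `(a, b) × (c, d)`. -/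
def rectangle (a b c d : ℝ) : Opens ℂ :=
  ⟨{z | a < z.re} ∩ {z | z.re < b} ∩ ({z | c < z.im} ∩ {z | z.im < d}),
    ((isOpen_lt continuous_const Complex.continuous_re).inter
      (isOpen_lt Complex.continuous_re continuous_const)).inter
    ((isOpen_lt continuous_const Complex.continuous_im).inter
      (isOpen_lt Complex.continuous_im continuous_const))⟩

lemma mem_rectangle {a b c d : ℝ} {z : ℂ} :
    z ∈ rectangle a b c d ↔ (a < z.re ∧ z.re < b) ∧ c < z.im ∧ z.im < d := Iff.rfl

lemma convex_rectangle (a b c d : ℝ) : Convex ℝ (rectangle a b c d : Set ℂ) :=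
  ((convex_halfSpace_re_gt _).inter (convex_halfSpace_re_lt _)).inter
    ((convex_halfSpace_im_gt _).inter (convex_halfSpace_im_lt _))

lemma rectangle_nonempty {a b c d : ℝ} (hab : a < b) (hcd : c < d) :
    (rectangle a b c d : Set ℂ).Nonempty := by
  refine ⟨⟨(a + b) / 2, (c + d) / 2⟩, ⟨?_, ?_⟩, ?_, ?_⟩ <;> simp only [Set.mem_ofPred_eq] <;>
    linarith

/-- An interval is the union of its left and right two thirds, which overlap in the middle third. So
a bound on the length can be raised by the factor `3 / 2` at each step, starting from `r`. -/
lemma interval_induction {P : ℝ → ℝ → Prop} {a b r : ℝ} (hr : 0 < r)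
    (small : ∀ s t, a ≤ s → s < t → t ≤ b → t - s ≤ r → P s t)
    (merge : ∀ s s' t t', a ≤ s → s < s' → s' < t → t < t' → t' ≤ b → P s t → P s' t' → P s t')
    (hab : a < b) : P a b := by
  have key (n : ℕ) : ∀ s t, a ≤ s → s < t → t ≤ b → t - s ≤ (3 / 2) ^ n * r → P s t := by
    induction n with
    | zero => simpa using small
    | succ n ih =>
      intro s t hs hst ht h
      rw [pow_succ] at h
      refine merge s (s + (t - s) / 3) (s + 2 * (t - s) / 3) t hs (by linarith) (by linarith)
        (by linarith) ht (ih _ _ hs ?_ ?_ ?_) (ih _ _ ?_ ?_ ht ?_) <;> linarith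
  obtain ⟨n, hn⟩ := pow_unbounded_of_one_lt ((b - a) / r) (by norm_num : (1 : ℝ) < 3 / 2)
  exact key n a b le_rfl hab le_rfl ((div_lt_iff₀ hr).1 hn).le

variable {X : Type u} [TopologicalSpace X] {S : TranslationSurface X} (B : S.FlowBox)

lemma isOpen_image {D : Set ℂ} (hD : IsOpen D) : IsOpen (B.toFun '' (D ∩ B.interior)) := by
  rw [isOpen_iff_mem_nhds]
  rintro _ ⟨z, hz, rfl⟩
  obtain ⟨e, he, hpe⟩ := S.covers _ (B.toFun_notMem_sing hz.2)
  have hs := (B.continuousAt hz.2).eventually (e.open_source.mem_nhds hpe)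
  have ht := B.translation z hz.2.1 hz.2.2.1 hz.2.2.2.1 hz.2.2.2.2 e he hpe
  have hlim : Tendsto (fun q => z + (e q - e (B.toFun z))) (𝓝 (B.toFun z)) (𝓝 z) := by
    have h := ((e.continuousAt hpe).tendsto.sub_const (e (B.toFun z))).const_add z
    simpa using h
  filter_upwards [hlim.eventually hs, hlim.eventually ht,
    hlim.eventually ((hD.inter B.isOpen_interior).mem_nhds hz),
    e.open_source.mem_nhds hpe] with q h1 h2 h3 h4
  refine ⟨_, h3, e.injOn h1 h4 ?_⟩
  rw [h2]; ring

/-- The part of a flow box over an open set of the plane. -/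
def subBox (D : Opens ℂ) : Opens S.puncturedTop :=
  ⟨Subtype.val ⁻¹' (B.toFun '' (D ∩ B.interior)), (isOpen_image B D.2).preimage
    continuous_subtype_val⟩

lemma subBox_mono {D D' : Opens ℂ} (h : D ≤ D') : subBox B D ≤ subBox B D' :=
  fun _ ⟨z, hz, e⟩ => ⟨z, ⟨h hz.1, hz.2⟩, e⟩

/-- Injectivity of the flow box makes overlaps on the surface come from overlaps in the plane, which
are convex when `D` and `D'` are. -/
lemma subBox_inf (D D' : Opens ℂ) : subBox B (D ⊓ D') = subBox B D ⊓ subBox B D' := by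
  refine le_antisymm (le_inf (subBox_mono B inf_le_left) (subBox_mono B inf_le_right)) ?_
  rintro p ⟨⟨z, hz, e⟩, ⟨w, hw, e'⟩⟩
  obtain rfl := B.injOn_interior hz.2 hw.2 (e.trans e'.symm)
  exact ⟨z, ⟨⟨hz.1, hw.1⟩, hz.2⟩, e⟩

lemma isConnected_subBox {D : Opens ℂ} (hD : Convex ℝ (D : Set ℂ))
    (hne : ((D : Set ℂ) ∩ B.interior).Nonempty) :
    IsConnected (subBox B D : Set S.puncturedTop) := by
  refine isConnected_preimage_val ?_ ⟨hne.image _, ?_⟩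
  · rintro _ ⟨z, hz, rfl⟩
    exact B.toFun_notMem_sing hz.2
  · exact (hD.inter B.convex_interior).isPreconnected.image _
      (B.continuousOn_domain.mono (Set.inter_subset_right.trans B.interior_subset_domain))

lemma rectangle_inter_interior_nonempty {a b c d : ℝ} (hab : a < b) (hcd : c < d) (ha : B.a ≤ a)
    (hb : b ≤ B.b) (hc : B.c ≤ c) (hd : d ≤ B.d) :
    ((rectangle a b c d : Set ℂ) ∩ B.interior).Nonempty := by
  obtain ⟨z, hz⟩ := rectangle_nonempty hab hcd
  obtain ⟨⟨h₁, h₂⟩, h₃, h₄⟩ := mem_rectangle.1 hz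
  exact ⟨z, hz, ha.trans_lt h₁, h₂.trans_le hb, hc.trans_lt h₃, h₄.trans_le hd⟩

lemma subBox_rectangle : subBox B (rectangle B.a B.b B.c B.d) = box B := by
  refine le_antisymm (fun p ⟨z, hz, e⟩ => ⟨z, hz.2, e⟩) fun p ⟨z, hz, e⟩ => ?_
  exact ⟨z, ⟨⟨⟨hz.1, hz.2.1⟩, hz.2.2⟩, hz⟩, e⟩

variable {C : Type*} [Category.{u} C] {E : TopCat.Sheaf C S.puncturedTop}

variable (E) in
/-- Two overlapping rectangles that are halves of a rectangle. -/
lemma isUniform_subBox_union {D D₁ D₂ : Opens ℂ} (h₁ : D₁ ≤ D) (h₂ : D₂ ≤ D)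
    (hD : ∀ z ∈ D, z ∈ D₁ ∨ z ∈ D₂) (hc₁ : Convex ℝ (D₁ : Set ℂ)) (hc₂ : Convex ℝ (D₂ : Set ℂ))
    (hne : ((D₁ ⊓ D₂ : Opens ℂ) ∩ B.interior : Set ℂ).Nonempty)
    (hE₁ : IsUniform E (subBox B D₁)) (hE₂ : IsUniform E (subBox B D₂)) :
    IsUniform E (subBox B D) := by
  have hI : IsConnected (subBox B (D₁ ⊓ D₂) : Set S.puncturedTop) :=
    isConnected_subBox B (hc₁.inter hc₂) hne
  have hI₁ := isConnected_subBox B hc₁ (hne.mono fun z hz => ⟨hz.1.1, hz.2⟩)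
  have hI₂ := isConnected_subBox B hc₂ (hne.mono fun z hz => ⟨hz.1.2, hz.2⟩)
  refine isUniform_of_cover E (fun i : Bool => subBox B (cond i D₁ D₂)) _ (subBox B (D₁ ⊓ D₂))
    ?_ ?_ ?_ hI ?_ ?_
  · rintro (_ | _)
    exacts [subBox_mono B h₂, subBox_mono B h₁]
  · rintro p ⟨z, hz, e⟩
    obtain h | h := hD z hz.1
    exacts [⟨true, z, ⟨h, hz.2⟩, e⟩, ⟨false, z, ⟨h, hz.2⟩, e⟩]
  · rintro (_ | _)
    exacts [subBox_mono B inf_le_right, subBox_mono B inf_le_left]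
  · rw [subBox_inf] at hI
    rintro (_ | _) (_ | _)
    · simpa using hI₂
    · simpa [inf_comm, Set.inter_comm] using hI
    · simpa using hI
    · simpa using hI₁
  · rintro (_ | _)
    exacts [hE₂, hE₁]

/-- A Lebesgue number for the cover of the compact rectangle by preimages of simple sets.
Compactness is why the rectangle stays strictly inside the box. -/
lemma isUniform_small_rectangle (hE : IsLocallyConstantSheaf E) {a b c d : ℝ} (ha : B.a < a)
    (hb : b < B.b) (hc : B.c < c) (hd : d < B.d) :
    ∃ r > 0, ∀ s t u v, a ≤ s → s < t → t ≤ b → c ≤ u → u < v → v ≤ d → t - s ≤ r → v - u ≤ r →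
      IsUniform E (subBox B (rectangle s t u v)) := by
  let ι := {O : Opens ℂ // ∃ U, IsSimple E U ∧ subBox B O ≤ U}
  have hK : IsCompact (Set.Icc a b ×ℂ Set.Icc c d) := isCompact_Icc.reProdIm isCompact_Icc
  obtain ⟨δ, hδ, h⟩ := lebesgue_number_lemma_of_metric (c := fun i : ι => (i.1 : Set ℂ)) hK
    (fun i => i.1.2) fun z hz => by
      have hz' : z ∈ B.interior := ⟨ha.trans_le hz.1.1, hz.1.2.trans_lt hb,
        hc.trans_le hz.2.1, hz.2.2.trans_lt hd⟩
      obtain ⟨U, hU, hEU⟩ := hE ⟨B.toFun z, B.toFun_notMem_sing hz'⟩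
      obtain ⟨W, hW, hWU⟩ := isOpen_induced_iff.1 U.2
      have hzW : B.toFun z ∈ W := by
        have : (⟨B.toFun z, B.toFun_notMem_sing hz'⟩ : (S.singᶜ : Set X)) ∈
          (Subtype.val ⁻¹' W : Set (S.singᶜ : Set X)) := hWU ▸ hU
        exact this
      obtain ⟨O, hO, hOo, hzO⟩ := mem_nhds_iff.1
        ((B.continuousAt hz').preimage_mem_nhds (hW.mem_nhds hzW))
      refine Set.mem_iUnion.2 ⟨⟨⟨O, hOo⟩, U, hEU, ?_⟩, hzO⟩
      rintro p ⟨w, hw, e⟩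
      have hpW : p ∈ (Subtype.val ⁻¹' W : Set (S.singᶜ : Set X)) := by
        rw [Set.mem_preimage, ← e]
        exact hO hw.1
      rwa [hWU] at hpW
  -- Distances from the corner `⟨s, u⟩` are at most the sum of the sides, hence at most `2 * δ / 3`.
  refine ⟨δ / 3, by positivity, fun s t u v hs hst ht hu huv hv h₁ h₂ => ?_⟩
  obtain ⟨⟨O, U, hU, hOU⟩, hi⟩ := h ⟨s, u⟩
    ⟨⟨hs, by simp only; linarith⟩, hu, by simp only; linarith⟩
  have hle : rectangle s t u v ≤ O := by
    rintro z ⟨⟨_, _⟩, _, _⟩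
    refine hi ?_
    simp only [Set.mem_ofPred_eq] at *
    rw [Metric.mem_ball, dist_eq_norm]
    refine (Complex.norm_le_abs_re_add_abs_im _).trans_lt ?_
    rw [Complex.sub_re, Complex.sub_im, abs_of_pos (by linarith), abs_of_pos (by linarith)]
    linarith
  refine hU.isUniform ((subBox_mono B hle).trans hOU)
    (isConnected_subBox B (convex_rectangle _ _ _ _)
      (rectangle_inter_interior_nonempty B hst huv ?_ ?_ ?_ ?_)) <;> linarith

/-- Small rectangles merge vertically into narrow strips, and strips merge horizontally: one
interval induction inside another. -/
lemma isUniform_rectangle (hE : IsLocallyConstantSheaf E) {a b c d : ℝ} (ha : B.a < a)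
    (hb : b < B.b) (hc : B.c < c) (hd : d < B.d) (hab : a < b) (hcd : c < d) :
    IsUniform E (subBox B (rectangle a b c d)) := by
  obtain ⟨r, hr, h⟩ := isUniform_small_rectangle B hE ha hb hc hd
  have hne {s t u v : ℝ} (hs : a ≤ s) (hst : s < t) (ht : t ≤ b) (hu : c ≤ u) (huv : u < v)
      (hv : v ≤ d) : ((rectangle s t u v : Set ℂ) ∩ B.interior).Nonempty :=
    rectangle_inter_interior_nonempty B hst huv (by linarith) (by linarith) (by linarith)
      (by linarith)
  refine interval_induction (P := fun s t => IsUniform E (subBox B (rectangle s t c d))) hr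
    (fun s t hs hst ht hrst => ?_) (fun s s' t t' hs h₁ h₂ h₃ ht' hP hP' => ?_) hab
  · refine interval_induction (P := fun u v => IsUniform E (subBox B (rectangle s t u v))) hr
      (fun u v hu huv hv hruv => h s t u v hs hst ht hu huv hv hrst hruv)
      (fun u u' v v' hu h₁ h₂ h₃ hv' hP hP' => ?_) hcd
    refine isUniform_subBox_union B E (fun z hz => ?_) (fun z hz => ?_) (fun z hz => ?_)
      (convex_rectangle _ _ _ _) (convex_rectangle _ _ _ _)
      ((hne (u := u') (v := v) hs hst ht (by linarith) h₂ (by linarith)).mono fun z hz =>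
        ⟨⟨?_, ?_⟩, hz.2⟩) hP hP'
    · exact ⟨hz.1, hz.2.1, hz.2.2.trans h₃⟩
    · exact ⟨hz.1, h₁.trans hz.2.1, hz.2.2⟩
    · obtain h | h := lt_or_ge z.im v
      · exact Or.inl ⟨hz.1, hz.2.1, h⟩
      · exact Or.inr ⟨hz.1, h₂.trans_le h, hz.2.2⟩
    · exact ⟨hz.1.1, h₁.trans hz.1.2.1, hz.1.2.2⟩
    · exact ⟨hz.1.1, hz.1.2.1, hz.1.2.2.trans h₃⟩
  · refine isUniform_subBox_union B E (fun z hz => ?_) (fun z hz => ?_) (fun z hz => ?_)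
      (convex_rectangle _ _ _ _) (convex_rectangle _ _ _ _)
      ((hne (s := s') (t := t) (by linarith) h₂ (by linarith) le_rfl hcd le_rfl).mono fun z hz =>
        ⟨⟨?_, ?_⟩, hz.2⟩) hP hP'
    · exact ⟨⟨hz.1.1, hz.1.2.trans h₃⟩, hz.2⟩
    · exact ⟨⟨h₁.trans hz.1.1, hz.1.2⟩, hz.2⟩
    · obtain h | h := lt_or_ge z.re t
      · exact Or.inl ⟨⟨hz.1.1, h⟩, hz.2⟩
      · exact Or.inr ⟨⟨h₂.trans_le h, hz.1.2⟩, hz.2⟩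
    · exact ⟨⟨h₁.trans hz.1.1.1, hz.1.1.2⟩, hz.1.2⟩
    · exact ⟨⟨hz.1.1.1, hz.1.1.2.trans h₃⟩, hz.1.2⟩

/-- A locally constant sheaf is constant on the open rectangle of a flow box. -/
lemma isUniform_box (hE : IsLocallyConstantSheaf E) : IsUniform E (box B) := by
  have hab := B.a_lt_b
  have hcd := B.c_lt_d
  obtain ⟨δ, hδ, hδ₁, hδ₂⟩ : ∃ δ > 0, 2 * δ < B.b - B.a ∧ 2 * δ < B.d - B.c := by
    refine ⟨min (B.b - B.a) (B.d - B.c) / 3, by simp [hab, hcd], ?_, ?_⟩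
    · linarith [min_le_left (B.b - B.a) (B.d - B.c)]
    · linarith [min_le_right (B.b - B.a) (B.d - B.c)]
  -- Exhaust the open box by inner rectangles `Q η`. They are nested, so their intersections are
  -- connected, and `Q δ` is a common core.
  let ι := {η : ℝ // 0 < η ∧ η ≤ δ}
  let Q (η : ℝ) := rectangle (B.a + η) (B.b - η) (B.c + η) (B.d - η)
  have hQ {η η' : ℝ} (h : η ≤ η') : Q η' ≤ Q η := fun z hz =>
    ⟨⟨(by linarith : B.a + η ≤ B.a + η').trans_lt hz.1.1,
      hz.1.2.trans_le (by linarith : B.b - η' ≤ B.b - η)⟩,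
      (by linarith : B.c + η ≤ B.c + η').trans_lt hz.2.1,
      hz.2.2.trans_le (by linarith : B.d - η' ≤ B.d - η)⟩
  have : Nonempty ι := ⟨⟨δ, hδ, le_rfl⟩⟩
  have hne (η : ι) : ((Q η.1 : Set ℂ) ∩ B.interior).Nonempty := by
    obtain ⟨η, h₀, h⟩ := η
    apply rectangle_inter_interior_nonempty <;> linarith
  have hconn (η : ι) : IsConnected (subBox B (Q η.1) : Set S.puncturedTop) :=
    isConnected_subBox B (convex_rectangle _ _ _ _) (hne η)
  refine isUniform_of_cover E (fun η : ι => subBox B (Q η.1)) _ (subBox B (Q δ))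
    (fun η => ?_) (fun p hp => ?_) (fun η => subBox_mono B (hQ η.2.2)) (hconn ⟨δ, hδ, le_rfl⟩)
    (fun η η' => ?_) fun η => ?_
  · rw [← subBox_rectangle]
    exact fun p ⟨z, hz, e⟩ => ⟨z, ⟨⟨⟨hz.2.1, hz.2.2.1⟩, hz.2.2.2⟩, hz.2⟩, e⟩
  · obtain ⟨z, hz, e⟩ := hp
    obtain ⟨h₁, h₂, h₃, h₄⟩ := hz
    obtain ⟨η, hη, hlt⟩ := exists_between (show 0 < min δ (min (min (z.re - B.a) (B.b - z.re))
      (min (z.im - B.c) (B.d - z.im))) by simp [*])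
    simp only [lt_min_iff] at hlt
    obtain ⟨h₅, ⟨h₆, h₇⟩, h₈, h₉⟩ := hlt
    refine ⟨⟨η, hη, h₅.le⟩, z, ⟨⟨⟨?_, ?_⟩, ?_, ?_⟩, h₁, h₂, h₃, h₄⟩, e⟩ <;>
      simp only [Set.mem_ofPred_eq] <;> linarith
  · obtain h | h := le_total η.1 η'.1
    · rw [inf_eq_right.2 (subBox_mono B (hQ h))]
      exact hconn η'
    · rw [inf_eq_left.2 (subBox_mono B (hQ h))]
      exact hconn η
  · obtain ⟨η, h₀, h⟩ := η
    exact isUniform_rectangle B hE (by linarith) (by linarith) (by linarith) (by linarith)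
      (by linarith) (by linarith)

end TranslationSurface

/-! ### The equivalence -/

lemma IsUniform.hasStalkIso {C : Type*} [Category.{u} C] {Y : TopCat.{u}}
    [LocallyConnectedSpace Y] {F : TopCat.Sheaf C Y} {U : Opens Y} (hF : IsUniform F U)
    {y : Y} (hy : y ∈ U) : HasStalkIso F y (F.1.obj (op U)) :=
  have := hF _ (componentIn_le U y) (isConnected_componentIn hy)
  (hF.isSimple.hasStalkIso hy).of_iso (asIso (resLE F (componentIn_le U y))).symm

namespace TranslationSurface

variable {X : Type u} [TopologicalSpace X] {S : TranslationSurface X}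
variable {C : Type*} [Category.{u} C]

/-- Every point of the divided surface has a neighborhood over which a locally constant sheaf is
constant: over a lane point this is the triviality of locally constant sheaves on a rectangle. -/
lemma exists_isSimple_shadow {E : TopCat.Sheaf C S.puncturedTop} (hE : IsLocallyConstantSheaf E)
    (y : S.dividedTop) : ∃ U : Opens S.dividedTop, y ∈ U ∧ IsSimple E (shadow U) := by
  obtain ⟨p, hp⟩ | l := y
  · obtain ⟨V, hpV, hV⟩ := hE ⟨p, hp⟩
    exact ⟨above V, embFun_mem_above hpV, (shadow_above V).symm ▸ hV⟩
  · obtain ⟨B, z, hz, hb, hg⟩ := l.exists_box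
    refine ⟨S.flowBox B, Or.inr ⟨l, rfl, z, hz, hb, hg⟩, ?_⟩
    rw [shadow_flowBox]
    exact (isUniform_box B hE).isSimple

variable [T2Space X]

/-- A locally constant sheaf on the divided surface does not see the lane points. -/
lemma isIso_resLE_above_shadow {F : TopCat.Sheaf C S.dividedTop} (hF : IsLocallyConstantSheaf F)
    (U : Opens S.dividedTop) : IsIso (resLE F (above_shadow_le U)) := by
  -- Within a simple set, choose `N` with connected trace: then `N` and `above (shadow N)` are both
  -- connected.
  have good {U : Opens S.dividedTop} (y : S.dividedTop) (hy : y ∈ U) :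
      ∃ N ≤ U, y ∈ N ∧ IsIso (resLE F (above_shadow_le N)) := by
    obtain ⟨N₀, hyN₀, hN₀⟩ := hF y
    obtain ⟨N, hN, hyN, hNc⟩ := exists_connected_shadow (N₀ ⊓ U) (y := y) ⟨hyN₀, hy⟩
    exact ⟨N, hN.trans inf_le_right, hyN, hN₀.isIso (above_shadow_le N) (hN.trans inf_le_left)
      (isConnected_above hNc) (isConnected_of_shadow hNc)⟩
  have inj {U : Opens S.dividedTop} {T : C} (s t : T ⟶ F.1.obj (op U))
      (h : s ≫ resLE F (above_shadow_le U) = t ≫ resLE F (above_shadow_le U)) : s = t := by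
    refine hom_ext_of_cover F s t fun y hy => ?_
    obtain ⟨N, hN, hyN, hiso⟩ := good y hy
    refine ⟨N, hN, hyN, ?_⟩
    rw [← cancel_mono (resLE F (above_shadow_le N)), Category.assoc, Category.assoc, resLE_comp,
      ← resLE_comp F (above_shadow_le U) (above_mono (shadow_mono hN)), reassoc_of% h]
  refine isIso_of_bijective _ (fun T s t => inj s t) fun T s => ?_
  choose N hN hyN hiso using @good U
  have hN' (y : U) : above (shadow (N y.1 y.2)) ≤ above (shadow U) :=
    above_mono (shadow_mono (hN y.1 y.2))
  have hiso' (y : U) := hiso y.1 y.2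
  obtain ⟨t, ht, -⟩ := exists_glue F (fun y : U => N y.1 y.2) U (fun y => hN _ _)
    (fun y hy => ⟨⟨y, hy⟩, hyN _ _⟩)
    (fun y => s ≫ resLE F (hN' y) ≫ inv (resLE F (above_shadow_le (N y.1 y.2)))) fun y z => by
      -- Over `above (shadow V)` every local candidate restricts to `s`, so `inj` forces the
      -- candidates to agree on overlaps.
      have key (y : U) (V : Opens S.dividedTop) (hV : V ≤ N y.1 y.2) :
          (s ≫ resLE F (hN' y) ≫ inv (resLE F (above_shadow_le (N y.1 y.2)))) ≫
            resLE F ((above_shadow_le V).trans hV) =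
          s ≫ resLE F ((above_mono (shadow_mono hV)).trans (hN' y)) := by
        rw [← resLE_comp F (above_shadow_le (N y.1 y.2)) (above_mono (shadow_mono hV))]
        rw [Category.assoc, Category.assoc, IsIso.inv_hom_id_assoc, resLE_comp]
      refine inj _ _ ?_
      simp only [Category.assoc, resLE_comp]
      simpa only [Category.assoc] using (key y _ inf_le_left).trans (key z _ inf_le_right).symm
  refine ⟨t, hom_ext_of_cover F _ _ ?_⟩
  rintro x ⟨p, hp, e⟩
  -- The neighborhood chosen for `ι p` serves every `x` over `p`, since `above` contains whole
  -- fibers.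
  let y : U := ⟨S.embFun p, hp⟩
  refine ⟨above (shadow (N y.1 y.2)), hN' y, ⟨p, hyN y.1 y.2, e⟩, ?_⟩
  rw [Category.assoc, resLE_comp, ← resLE_comp F (hN y.1 y.2) (above_shadow_le _),
    reassoc_of% (ht y)]
  simp

lemma isIso_map_trim {F : TopCat.Sheaf C S.dividedTop} (hF : IsLocallyConstantSheaf F)
    (B : S.FlowBox) : IsIso (F.1.map (homOfLE (S.trim_le_flowBox B)).op) := by
  have h := isIso_resLE_above_shadow hF (S.flowBox B)
  have e : above (shadow (S.flowBox B)) = S.trim B := by rw [shadow_flowBox, above_box]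
  have (V : Opens S.dividedTop) (hV : V ≤ S.flowBox B) (e : above (shadow (S.flowBox B)) = V) :
      IsIso (resLE F hV) := by subst e; exact h
  exact this _ _ e

lemma isSimple_projDirectImage {F : TopCat.Sheaf C S.dividedTop} {U : Opens S.dividedTop}
    (hF : IsSimple F U) : IsSimple ((S.projDirectImage C).obj F) (shadow U) := by
  obtain ⟨A, φ, hφ⟩ := hF
  have hle {V : Opens S.puncturedTop} (hV : V ≤ shadow U) : above V ≤ U :=
    (above_mono hV).trans (above_shadow_le U)
  exact ⟨A, fun V hV hVc => φ (above V) (hle hV) (isConnected_above hVc),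
    fun V W hVW hW hVc hWc =>
      hφ (above V) (above W) (above_mono hVW) (hle hW) (isConnected_above hVc)
        (isConnected_above hWc)⟩

lemma isSimple_embDirectImage {E : TopCat.Sheaf C S.puncturedTop} {U : Opens S.dividedTop}
    (hE : IsSimple E (shadow U)) : IsSimple ((S.embDirectImage C).obj E) U := by
  obtain ⟨A, φ, hφ⟩ := hE
  exact ⟨A, fun V hV hVc => φ (shadow V) (shadow_mono hV) (isConnected_shadow hVc),
    fun V W hVW hW hVc hWc =>
      hφ (shadow V) (shadow W) (shadow_mono hVW) (shadow_mono hW) (isConnected_shadow hVc)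
        (isConnected_shadow hWc)⟩

/-! ### The two functors on local systems -/

variable {k : Type u} [Field k] {R : Type u} [AddCommGroup R] [Module k R]
  {G : Subgroup (R ≃ₗ[k] R)}

/-- For small `N` around `ι p`, the stalk of `π_* F` at `p` is `F(above (shadow N))`, which is
`F(N)`, the stalk of `F` at `ι p`. -/
lemma isLocalSystem_projDirectImage {F : TopCat.Sheaf (LinearGroupCat G) S.dividedTop}
    (hF : isLocalSystem G S.dividedTop F) :
    isLocalSystem G S.puncturedTop ((S.projDirectImage (LinearGroupCat G)).obj F) := by
  refine ⟨fun p => ?_, fun p => ?_⟩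
  · obtain ⟨U, hpU, hU⟩ := hF.1 (S.embFun p)
    exact ⟨shadow U, hpU, isSimple_projDirectImage hU⟩
  · obtain ⟨U, hpU, hU⟩ := hF.1 (S.embFun p)
    obtain ⟨N, hN, hpN, hNc⟩ := exists_connected_shadow U hpU
    have hNc' := isConnected_of_shadow hNc
    obtain ⟨i⟩ := HasStalkIso.unique ((hU.isUniform hN hNc').hasStalkIso hpN)
      (hF.2 (S.embFun p))
    have := isIso_resLE_above_shadow hF.1 N
    exact (((isSimple_projDirectImage hU).isUniform (shadow_mono hN) hNc).hasStalkIso hpN).of_iso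
      ((asIso (resLE F (above_shadow_le N))).symm ≪≫ i)

/-- The stalk at `y`, possibly a lane point, is `E(shadow N)` for small `N`; this is also the stalk
of `E` at any point `p` of `shadow N`. -/
lemma isLocalSystem_embDirectImage {E : TopCat.Sheaf (LinearGroupCat G) S.puncturedTop}
    (hE : isLocalSystem G S.puncturedTop E) :
    isLocalSystem G S.dividedTop ((S.embDirectImage (LinearGroupCat G)).obj E) := by
  refine ⟨fun y => ?_, fun y => ?_⟩
  · obtain ⟨U, hyU, hU⟩ := exists_isSimple_shadow hE.1 y
    exact ⟨U, hyU, isSimple_embDirectImage hU⟩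
  · obtain ⟨U, hyU, hU⟩ := exists_isSimple_shadow hE.1 y
    obtain ⟨N, hN, hyN, hNc⟩ := exists_connected_shadow U hyU
    have hNc' := isConnected_of_shadow hNc
    obtain ⟨p, hp⟩ := hNc.nonempty
    obtain ⟨i⟩ := HasStalkIso.unique
      ((hU.isUniform (shadow_mono hN) hNc).hasStalkIso hp) (hE.2 p)
    exact (((isSimple_embDirectImage hU).isUniform hN hNc').hasStalkIso hyN).of_iso i

/-- The restriction maps from a sheaf on the divided surface to the direct image of its direct
image. -/
noncomputable def unitHom (F : TopCat.Sheaf C S.dividedTop) :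
    F ⟶ (S.embDirectImage C).obj ((S.projDirectImage C).obj F) :=
  ⟨{ app := fun U => resLE F (above_shadow_le U.unop)
     naturality := fun U V f => by
      have hle : V.unop ≤ U.unop := leOfHom f.unop
      exact (resLE_comp F hle (above_shadow_le _)).trans
        (resLE_comp F (above_shadow_le _) (above_mono (shadow_mono hle))).symm }⟩

lemma isIso_unitHom {F : TopCat.Sheaf C S.dividedTop} (hF : IsLocallyConstantSheaf F) :
    IsIso (unitHom F) := by
  have (U : (Opens S.dividedTop)ᵒᵖ) : IsIso ((unitHom F).hom.app U) :=
    isIso_resLE_above_shadow hF U.unop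
  have : IsIso (unitHom F).hom := NatIso.isIso_of_isIso_app _
  exact (ObjectProperty.isoMk _ (asIso (unitHom F).hom)).isIso_hom

/-- The direct image of the direct image of a sheaf on the surface minus its singularities. -/
noncomputable def counitIso (E : TopCat.Sheaf C S.puncturedTop) :
    (S.projDirectImage C).obj ((S.embDirectImage C).obj E) ≅ E :=
  ObjectProperty.isoMk _
    (NatIso.ofComponents (fun V => E.1.mapIso (eqToIso (shadow_above V.unop).symm).op)
      fun {V W} f => by
        have hle : W.unop ≤ V.unop := leOfHom f.unop
        exact (resLE_comp E (shadow_mono (above_mono hle)) (shadow_above W.unop).ge).trans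
          (resLE_comp E (shadow_above V.unop).ge hle).symm)

variable (G S)

/-- The direct image functor `π_*` on local systems. -/
noncomputable abbrev projLocalSystem : LocalSystem G S.dividedTop ⥤ LocalSystem G S.puncturedTop :=
  (isLocalSystem G S.puncturedTop).lift
    ((isLocalSystem G S.dividedTop).ι ⋙ S.projDirectImage (LinearGroupCat G))
    fun F => isLocalSystem_projDirectImage F.property

/-- The direct image functor `ι_*` on local systems. -/
noncomputable abbrev embLocalSystem : LocalSystem G S.puncturedTop ⥤ LocalSystem G S.dividedTop :=
  (isLocalSystem G S.dividedTop).lift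
    ((isLocalSystem G S.puncturedTop).ι ⋙ S.embDirectImage (LinearGroupCat G))
    fun E => isLocalSystem_embDirectImage E.property

/-- Going to the surface and back does not change local systems on the divided surface. -/
noncomputable def unitLocalSystem :
    𝟭 (LocalSystem G S.dividedTop) ≅ projLocalSystem S G ⋙ embLocalSystem S G :=
  NatIso.ofComponents
    (fun F => ObjectProperty.isoMk (isLocalSystem G S.dividedTop)
      (@asIso _ _ _ _ (unitHom F.obj) (isIso_unitHom F.property.1)))
    fun {F F'} f => by
      apply ObjectProperty.hom_ext
      apply ObjectProperty.hom_ext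
      ext U : 2
      exact (f.hom.hom.naturality (homOfLE (above_shadow_le U.unop)).op).symm

/-- Going to the divided surface and back does not change local systems on the surface. -/
noncomputable def counitLocalSystem :
    embLocalSystem S G ⋙ projLocalSystem S G ≅ 𝟭 (LocalSystem G S.puncturedTop) :=
  NatIso.ofComponents
    (fun E => ObjectProperty.isoMk (isLocalSystem G S.puncturedTop) (counitIso E.obj))
    fun {E E'} f => by
      apply ObjectProperty.hom_ext
      apply ObjectProperty.hom_ext
      ext V : 2
      exact (f.hom.hom.naturality (homOfLE (shadow_above V.unop).ge).op).symm

end TranslationSurface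

theorem mainTheorem2 {k : Type u} [Field k] {R : Type u} [AddCommGroup R] [Module k R]
    [FiniteDimensional k R] (G : Subgroup (R ≃ₗ[k] R))
    {X : Type u} [TopologicalSpace X] [T2Space X] [CompactSpace X] (S : TranslationSurface X) :
    (∃ (hπ : ∀ F : LocalSystem G S.dividedTop,
          isLocalSystem G S.puncturedTop ((S.projDirectImage (LinearGroupCat G)).obj F.obj))
       (hι : ∀ E : LocalSystem G S.puncturedTop,
          isLocalSystem G S.dividedTop ((S.embDirectImage (LinearGroupCat G)).obj E.obj))
       (e : LocalSystem G S.dividedTop ≌ LocalSystem G S.puncturedTop),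
        e.functor = (isLocalSystem G S.puncturedTop).lift
          ((isLocalSystem G S.dividedTop).ι ⋙ S.projDirectImage (LinearGroupCat G)) hπ ∧
        e.inverse = (isLocalSystem G S.dividedTop).lift
          ((isLocalSystem G S.puncturedTop).ι ⋙ S.embDirectImage (LinearGroupCat G)) hι) ∧
    ∀ (F : LocalSystem G S.dividedTop) (B : S.FlowBox),
      IsIso (F.obj.1.map (homOfLE (S.trim_le_flowBox B)).op) := by
  exact ⟨⟨fun F => S.isLocalSystem_projDirectImage F.property,
    fun E => S.isLocalSystem_embDirectImage E.property,
    -- The construction alters at most the unit, to obtain the triangle identities, so both functors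
    -- are as given.
    CategoryTheory.Equivalence.mk (S.projLocalSystem G) (S.embLocalSystem G)
      (S.unitLocalSystem G) (S.counitLocalSystem G), rfl, rfl⟩,
    fun F B => TranslationSurface.isIso_map_trim F.property.1 B⟩
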